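/- All graphs are finite, simple and undirected; $K_n$ is the complete graph on $n$ vertices. A graph is \emph{biconnected} if it is connected and has no cut vertex (so $K_1$ and $K_2$ are biconnected). A graph $H$ is a \emph{minor} (resp. an \emph{induced minor}) of $G$ if a graph isomorphic to $H$ arises from $G$ by vertex deletions, edge deletions and edge contractions (resp. by vertex deletions and edge contractions); equivalently, if there are pairwise disjoint nonempty sets $S_v\subseteq V(G)$, $v\in V(H)$, each inducing a connected subgraph of $G$, such that for all distinct $u,v\in V(H)$ some edge of $G$ joins $S_u$ to $S_v$ if (resp. if and only if) $uv\in E(H)$. The graph $G$ is \emph{$H$-minor-free} (resp. \emph{$H$-induced-minor-free}) if $H$ is not a minor (resp. not an induced minor) of $G$; for a set $\mathcal F$ of graphs it is \emph{$\mathcal F$-induced-minor-free} if it is $H$-induced-minor-free for every $H\in\mathcal F$. Let $F_1$ be the domino, i.e. the graph with $6$ vertices and $7$ edges consisting of two $4$-cycles that share exactly one edge. A vertex is \emph{simplicial} if its neighborhood is a clique. The \emph{$2$-trees} are the graphs obtained from $K_2$, and the \emph{hollowed $2$-trees} are the graphs obtained from a cycle of length at least four, by a (possibly empty) sequence of additions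 of simplicial vertices of degree $2$. An orientation of $G$ is \emph{$1$-perfect} if the out-neighborhood of every vertex induces a tournament; $G$ is \emph{$1$-perfectly orientable} if it has a $1$-perfect orientation. An orientation is \emph{sink-free} if every vertex has an out-neighbor. \textbf{Lemma.} For every biconnected $K_4$-minor-free graph $G$, the following statements are equivalent: \begin{enumerate} \item $G$ is $1$-perfectly orientable. \item $G$ is $\{K_{2,3},F_1\}$-induced-minor-free. \item $G$ is either $K_1$, a $2$-tree, or a hollowed $2$-tree. \item $G$ is either $K_1$, $K_2$, or can be constructed from a cycle (of length at least $3$) by a (possibly empty) sequence of additions of simplicial vertices of degree $2$. \item $G$ is either $K_1$, $K_2$, or has a sink-free $1$-perfect orientation. \end{enumerate} -/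

import Mathlib

universe u

namespace SimpleGraph

/-- `v` is a cut vertex of `G` if the graph `G - v` is disconnected. The empty graph (which is
`G - v` when `v` is the only vertex) does not count as disconnected. -/
def IsCutVertex {V : Type*} (G : SimpleGraph V) (v : V) : Prop :=
  ¬ (G.induce {v}ᶜ).Preconnected

/-- A graph is biconnected if it is connected and has no cut vertices (`K₁` and `K₂` are
biconnected). -/
def IsBiconnected {V : Type*} (G : SimpleGraph V) : Prop :=
  G.Connected ∧ ∀ v, ¬ G.IsCutVertex v

/-- `S` is a minor model of `H` in `G`: pairwise disjoint (nonempty) connected vertex sets `S v`,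
with an edge of `G` between `S u` and `S v` whenever `u` and `v` are adjacent in `H`. -/
structure IsMinorModel {V W : Type*} (G : SimpleGraph V) (H : SimpleGraph W)
    (S : W → Set V) : Prop where
  disjoint : ∀ u v, u ≠ v → Disjoint (S u) (S v)
  connected : ∀ v, (G.induce (S v)).Connected
  adj : ∀ u v, H.Adj u v → ∃ x ∈ S u, ∃ y ∈ S v, G.Adj x y

/-- `S` is an induced minor model of `H` in `G`: pairwise disjoint (nonempty) connected vertex
sets `S v` such that, for distinct `u` and `v`, there is an edge of `G` between `S u` and `S v` if
and only if `u` and `v` are adjacent in `H`. -/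
structure IsInducedMinorModel {V W : Type*} (G : SimpleGraph V) (H : SimpleGraph W)
    (S : W → Set V) : Prop where
  disjoint : ∀ u v, u ≠ v → Disjoint (S u) (S v)
  connected : ∀ v, (G.induce (S v)).Connected
  adj_iff : ∀ u v, u ≠ v → (H.Adj u v ↔ ∃ x ∈ S u, ∃ y ∈ S v, G.Adj x y)

/-- `G` is `H`-minor-free. -/
def MinorFree {V W : Type*} (G : SimpleGraph V) (H : SimpleGraph W) : Prop :=
  ¬ ∃ S : W → Set V, G.IsMinorModel H S

/-- `G` is `H`-induced-minor-free. -/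
def InducedMinorFree {V W : Type*} (G : SimpleGraph V) (H : SimpleGraph W) : Prop :=
  ¬ ∃ S : W → Set V, G.IsInducedMinorModel H S

/-- The domino: the two 4-cycles `0 1 3 2` and `0 1 5 4`, which share exactly the edge `0 1`. -/
def domino : SimpleGraph (Fin 6) :=
  fromEdgeSet {s(0, 1), s(1, 3), s(3, 2), s(2, 0), s(1, 5), s(5, 4), s(4, 0)}

/-- A vertex is simplicial if its neighborhood is a clique. -/
def IsSimplicial {V : Type*} (G : SimpleGraph V) (v : V) : Prop :=
  G.IsClique (G.neighborSet v)

/-- `BuiltFrom B G`: up to isomorphism, `G` is obtained from `B` by a (possibly empty) sequence of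
additions of simplicial vertices of degree 2. A step says that `G` arises from `G - v` by adding
the vertex `v`, which is simplicial and of degree 2 in `G`. -/
inductive BuiltFrom {W : Type*} (B : SimpleGraph W) :
    ∀ {V : Type u}, SimpleGraph V → Prop
  | base {V : Type u} (G : SimpleGraph V) (e : G ≃g B) : BuiltFrom B G
  | add {V : Type u} (G : SimpleGraph V) (v : V) (simplicial : G.IsSimplicial v)
      (degree : (G.neighborSet v).ncard = 2) (h : BuiltFrom B (G.induce {v}ᶜ)) : BuiltFrom B G

/-- 2-trees: the smallest class containing `K₂` and closed under additions of simplicial vertices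
of degree 2. -/
def IsTwoTree {V : Type u} (G : SimpleGraph V) : Prop :=
  BuiltFrom (completeGraph (Fin 2)) G

/-- Hollowed 2-trees: the smallest class containing all cycles of length at least four and closed
under additions of simplicial vertices of degree 2. -/
def IsHollowedTwoTree {V : Type u} (G : SimpleGraph V) : Prop :=
  ∃ n : ℕ, 4 ≤ n ∧ BuiltFrom (cycleGraph n) G

/-- `G` is (isomorphic to) the complete graph `K_n`. -/
def IsK {V : Type*} (n : ℕ) (G : SimpleGraph V) : Prop :=
  Nonempty (G ≃g completeGraph (Fin n))

/-- The digraph `D` is an orientation of `G`: every edge of `G` gets exactly one of its two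
directions, and `D` has no other arcs. -/
structure IsOrientation {V : Type*} (G : SimpleGraph V) (D : Digraph V) : Prop where
  adj_iff : ∀ v w, G.Adj v w ↔ D.Adj v w ∨ D.Adj w v
  asymm : ∀ v w, D.Adj v w → ¬ D.Adj w v

/-- `D` is a 1-perfect orientation of `G`: an orientation of `G` in which the out-neighborhood of
every vertex induces a tournament. -/
structure IsOnePerfectOrientation {V : Type*} (G : SimpleGraph V) (D : Digraph V) : Prop where
  isOrientation : G.IsOrientation D
  tournament : ∀ v x y, D.Adj v x → D.Adj v y → x ≠ y → Xor (D.Adj x y) (D.Adj y x)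

/-- `G` is 1-perfectly orientable. -/
def OnePerfectlyOrientable {V : Type*} (G : SimpleGraph V) : Prop :=
  ∃ D : Digraph V, G.IsOnePerfectOrientation D

end SimpleGraph

namespace Digraph

/-- A sink is a vertex of out-degree zero. -/
def IsSink {V : Type*} (D : Digraph V) (v : V) : Prop :=
  ∀ w, ¬ D.Adj v w

/-- A digraph is sink-free if it has no sinks. -/
def SinkFree {V : Type*} (D : Digraph V) : Prop :=
  ∀ v, ¬ D.IsSink v

end Digraph

/-!
The equivalence of the last three conditions is constructive: a triangle arises from `K₂` by adding
one vertex, and the cyclic orientation of a cycle extends to every simplicial vertex of degree two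
added to it by making this vertex a source (`BuiltFrom.exists_orientation`).

A 1-perfectly orientable graph has no induced minor `K_{2,3}` or domino by a counting argument
(`OnePerfectlyOrientable.card_edgeFinset_le`) that avoids contractions. Fix a 1-perfect orientation
and an induced minor model of a graph `H`. Each branch set `A`, being connected, has a root that all
of `A` reaches by directed paths inside `A`: the head of an arc out of a vertex `a` is adjacent to
the other out-neighbors of `a`, so an arc can be pushed along a directed path. Pushing an arc
between two branch sets in this way towards their roots shows that one of the two roots has an
out-neighbor in the other set. Thus every edge of `H` receives a direction, and the out-neighbors
of a vertex of `H` are pairwise adjacent. If `H` is triangle-free, all out-degrees are at most one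
and `H` has at most as many edges as vertices, which fails for `K_{2,3}` and for the domino.

Conversely, let `G` be biconnected with at least three vertices and without the forbidden minors
(`IsBiconnected.builtFrom_cycleGraph`). Take an induced cycle `C`, of length at least four if there
is one. A component `K` of `G - C` has at least two neighbors on `C` by biconnectivity, not three
because of `K₄`, and not two nonadjacent ones because of `K_{2,3}`; so it is attached to an edge
`x y` of `C`. The graph induced by `K`, `x` and `y` is again biconnected, and by induction it is
built from a cycle. If that cycle has length at least four, then so does `C`, and contracting both
sides to 4-cycles through `x y` (`BuiltFrom.exists_isRootedSquare`) gives a domino. Otherwise the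
part is a 2-tree and has a simplicial vertex of degree two in `K`
(`BuiltFrom.exists_simplicial`); it is also one of `G`, and induction applies to `G` without it.
-/

namespace SimpleGraph

variable {V W : Type*} {G : SimpleGraph V}

/-! ### Connectivity of induced subgraphs -/

theorem induce_preconnected_iff {S : Set V} :
    (G.induce S).Preconnected ↔
      ∀ R ⊆ S, R.Nonempty → (∀ u ∈ R, ∀ v ∈ S, G.Adj u v → v ∈ R) → S ⊆ R := by
  constructor
  · rintro h R hRS ⟨r, hr⟩ hcl s hs
    by_contra hsR
    obtain ⟨p⟩ := h ⟨r, hRS hr⟩ ⟨s, hs⟩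
    obtain ⟨d, -, h1, h2⟩ := p.exists_boundary_dart (Subtype.val ⁻¹' R) hr hsR
    exact h2 (hcl _ h1 _ d.snd.2 d.adj)
  · intro h a b
    have := h {x | ∃ hx : x ∈ S, (G.induce S).Reachable a ⟨x, hx⟩} (fun x hx => hx.1)
      ⟨a, a.2, Reachable.refl _⟩ ?_ b.2
    · exact this.2
    · rintro u ⟨hu, hau⟩ v hv huv
      exact ⟨hv, hau.trans (Adj.reachable (G := G.induce S) (u := ⟨u, hu⟩) (v := ⟨v, hv⟩) huv)⟩

/-- An induced subgraph is connected iff it is nonempty and no nonempty proper subset of its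
vertices is closed under adjacency within it. -/
theorem induce_connected_iff {S : Set V} :
    (G.induce S).Connected ↔
      S.Nonempty ∧ ∀ R ⊆ S, R.Nonempty → (∀ u ∈ R, ∀ v ∈ S, G.Adj u v → v ∈ R) → S ⊆ R := by
  rw [connected_iff, induce_preconnected_iff, Set.nonempty_coe_sort, and_comm]

theorem preconnected_iff_forall_closed :
    G.Preconnected ↔ ∀ R : Set V, R.Nonempty → (∀ u ∈ R, ∀ v, G.Adj u v → v ∈ R) → ∀ v, v ∈ R := by
  have h : (G.induce Set.univ).Preconnected ↔ G.Preconnected :=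
    (induceUnivIso G).preconnected_iff
  rw [← h, induce_preconnected_iff]
  simp [Set.eq_univ_iff_forall, Set.univ_subset_iff]

theorem induce_connected_image {G' : SimpleGraph W} (e : G' ↪g G) {S : Set W}
    (h : (G'.induce S).Connected) : (G.induce (e '' S)).Connected := by
  rw [induce_connected_iff] at h ⊢
  obtain ⟨hne, h⟩ := h
  refine ⟨hne.image e, fun R hR ⟨r, hr⟩ hcl => ?_⟩
  obtain ⟨w, hw, rfl⟩ := hR hr
  have := h (S ∩ e ⁻¹' R) Set.inter_subset_left ⟨w, hw, hr⟩ fun u hu v hv huv =>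
    ⟨hv, hcl _ hu.2 _ ⟨v, hv, rfl⟩ (e.map_rel_iff.2 huv)⟩
  rintro _ ⟨s, hs, rfl⟩
  exact (this hs).2

theorem induce_singleton_connected (v : V) : (G.induce {v}).Connected := by
  rw [induce_connected_iff]
  refine ⟨Set.singleton_nonempty v, fun R hR ⟨r, hr⟩ _ => ?_⟩
  rintro _ rfl
  exact hR hr ▸ hr

theorem induce_insert_connected {S : Set V} {s v : V} (h : (G.induce S).Connected) (hs : s ∈ S)
    (hsv : G.Adj s v) : (G.induce (insert v S)).Connected := by
  rw [Set.insert_eq]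
  exact connected_induce_union (induce_singleton_connected v).preconnected
    h.preconnected (Set.mem_singleton v) hs hsv.symm

/-! ### Minor models -/

theorem IsMinorModel.map {U : Type*} {H : SimpleGraph U} {G' : SimpleGraph W} {S : U → Set W}
    (h : G'.IsMinorModel H S) (e : G' ↪g G) : G.IsMinorModel H (fun u => e '' S u) where
  disjoint u v huv := (Set.disjoint_image_iff e.injective).2 (h.disjoint u v huv)
  connected v := induce_connected_image e (h.connected v)
  adj u v huv := by
    obtain ⟨x, hx, y, hy, hxy⟩ := h.adj u v huv
    exact ⟨e x, ⟨x, hx, rfl⟩, e y, ⟨y, hy, rfl⟩, e.map_rel_iff.2 hxy⟩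

theorem IsInducedMinorModel.map {U : Type*} {H : SimpleGraph U} {G' : SimpleGraph W}
    {S : U → Set W} (h : G'.IsInducedMinorModel H S) (e : G' ↪g G) :
    G.IsInducedMinorModel H (fun u => e '' S u) where
  disjoint u v huv := (Set.disjoint_image_iff e.injective).2 (h.disjoint u v huv)
  connected v := induce_connected_image e (h.connected v)
  adj_iff u v huv := by
    rw [h.adj_iff u v huv]
    simp [Embedding.map_adj_iff]

theorem MinorFree.induce {U : Type*} {H : SimpleGraph U} (h : G.MinorFree H) (T : Set V) :
    (G.induce T).MinorFree H :=
  fun ⟨_, hS⟩ => h ⟨_, hS.map (Embedding.induce T)⟩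

theorem InducedMinorFree.induce {U : Type*} {H : SimpleGraph U} (h : G.InducedMinorFree H)
    (T : Set V) : (G.induce T).InducedMinorFree H :=
  fun ⟨_, hS⟩ => h ⟨_, hS.map (Embedding.induce T)⟩

/-! ### Induced minors of 1-perfectly orientable graphs -/

/-- In a 1-perfect orientation, a connected set `A` has a vertex that every vertex of `A` reaches
by a directed path inside `A`. -/
theorem IsOnePerfectOrientation.exists_root [Finite V] {D : Digraph V}
    (hD : G.IsOnePerfectOrientation D) {A : Set V} (hA : (G.induce A).Connected) :
    ∃ r ∈ A, ∀ a ∈ A, Relation.ReflTransGen (fun x y => D.Adj x y ∧ y ∈ A) a r := by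
  rw [induce_connected_iff] at hA
  obtain ⟨hne, hA⟩ := hA
  let anc : V → Set V := fun r => {a ∈ A | Relation.ReflTransGen (fun x y => D.Adj x y ∧ y ∈ A) a r}
  -- A vertex with the largest set of ancestors is a root.
  obtain ⟨r, hr, hmax⟩ := Set.exists_max_image A (fun r => (anc r).ncard) A.toFinite hne
  refine ⟨r, hr, ?_⟩
  suffices A ⊆ anc r from fun a ha => (this ha).2
  refine hA _ (fun a ha => ha.1) ⟨r, hr, .refl⟩ ?_
  rintro x ⟨hx, hxr⟩ y hy hxy
  by_contra hyr
  have hyr' : ¬ Relation.ReflTransGen (fun x y => D.Adj x y ∧ y ∈ A) y r := fun h => hyr ⟨hy, h⟩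
  have key : ∀ z, Relation.ReflTransGen (fun x y => D.Adj x y ∧ y ∈ A) z r → z ∈ A → G.Adj z y →
      D.Adj z y := fun z hz hzA hzy => by
    rcases (hD.isOrientation.adj_iff z y).1 hzy with h | h
    · exact h
    · exact absurd (Relation.ReflTransGen.head ⟨h, hzA⟩ hz) hyr'
  -- The arc into `y` moves along the directed path from `x` to `r`.
  have hry : D.Adj r y := by
    have : ∀ z, Relation.ReflTransGen (fun x y => D.Adj x y ∧ y ∈ A) z r → D.Adj z y →
        D.Adj r y := by
      intro z hz
      induction hz using Relation.ReflTransGen.head_induction_on with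
      | refl => exact id
      | head hac hcr ih =>
        intro hay
        rename_i a c
        refine ih (key c hcr hac.2 ((hD.isOrientation.adj_iff c y).2 ?_))
        have hcy : c ≠ y := fun h => hyr' (h ▸ hcr)
        rcases hD.tournament a c y hac.1 hay hcy with h | h
        · exact .inl h.1
        · exact .inr h.1
    exact this x hxr (key x hxr hx hxy)
  have hlt : (anc r).ncard < (anc y).ncard := by
    refine Set.ncard_lt_ncard ⟨fun a ha => ⟨ha.1, ha.2.tail ⟨hry, hy⟩⟩, fun h => hyr ?_⟩
      (Set.toFinite _)
    exact h ⟨hy, .refl⟩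
  exact (hmax y hy).not_gt hlt

/-- If `A` and `B` are adjacent sets with roots `r` and `s`, then `r` has an out-neighbor in `B` or
`s` has one in `A`: an arc between the two sets can be moved forward along the directed paths to the
roots. -/
theorem IsOnePerfectOrientation.root_adj {D : Digraph V} (hD : G.IsOnePerfectOrientation D)
    {A B : Set V} (hAB : Disjoint A B) {r s : V} {a b : V} (ha : a ∈ A) (hb : b ∈ B)
    (har : Relation.ReflTransGen (fun x y => D.Adj x y ∧ y ∈ A) a r)
    (hbs : Relation.ReflTransGen (fun x y => D.Adj x y ∧ y ∈ B) b s) (hab : G.Adj a b) :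
    (∃ y ∈ B, D.Adj r y) ∨ ∃ x ∈ A, D.Adj s x := by
  have move : ∀ x y z, D.Adj x y → D.Adj x z → y ≠ z → G.Adj y z := fun x y z hy hz hyz => by
    rw [hD.isOrientation.adj_iff]
    exact (hD.tournament x y z hy hz hyz).imp And.left And.left
  induction har using Relation.ReflTransGen.head_induction_on generalizing b with
  | refl =>
    induction hbs using Relation.ReflTransGen.head_induction_on with
    | refl => exact ((hD.isOrientation.adj_iff _ _).1 hab).imp (⟨_, hb, ·⟩) (⟨_, ha, ·⟩)
    | head hbc hcs ih =>
      rcases (hD.isOrientation.adj_iff _ _).1 hab with h | h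
      · exact .inl ⟨_, hb, h⟩
      · exact ih hbc.2 (move _ _ _ h hbc.1 (hAB.ne_of_mem ha hbc.2))
  | head hac hcr ih =>
    rename_i a c
    induction hbs using Relation.ReflTransGen.head_induction_on with
    | refl =>
      rcases (hD.isOrientation.adj_iff _ _).1 hab with h | h
      · exact ih hac.2 hb .refl (move _ _ _ hac.1 h (hAB.ne_of_mem hac.2 hb))
      · exact .inr ⟨_, ha, h⟩
    | head hbd hds ih' =>
      rcases (hD.isOrientation.adj_iff _ _).1 hab with h | h
      · exact ih hac.2 hb (hds.head hbd) (move _ _ _ hac.1 h (hAB.ne_of_mem hac.2 hb))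
      · exact ih' hbd.2 (move _ _ _ h hbd.1 (hAB.ne_of_mem ha hbd.2))

/-- A triangle-free induced minor of a 1-perfectly orientable graph has at most as many edges as
vertices: every edge gets a direction such that each vertex has out-degree at most one. -/
theorem OnePerfectlyOrientable.card_edgeFinset_le [Finite V] (hG : G.OnePerfectlyOrientable)
    [Fintype W] [DecidableEq W] {H : SimpleGraph W} [DecidableRel H.Adj]
    (hH : ∀ a b c, H.Adj a b → H.Adj a c → ¬ H.Adj b c) {S : W → Set V}
    (hS : G.IsInducedMinorModel H S) : H.edgeFinset.card ≤ Fintype.card W := by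
  classical
  obtain ⟨D, hD⟩ := hG
  choose r hr hroot using fun w => hD.exists_root (hS.connected w)
  have hout : ∀ a b, a ≠ b → ∀ y ∈ S b, D.Adj (r a) y → H.Adj a b := fun a b hab y hy h =>
    (hS.adj_iff a b hab).2 ⟨r a, hr a, y, hy, (hD.isOrientation.adj_iff _ _).2 (.inl h)⟩
  -- `out a` is the unique out-neighbor of `a` in `H`, and `a` itself if there is none.
  let out : W → W := fun a => if h : ∃ b, b ≠ a ∧ ∃ y ∈ S b, D.Adj (r a) y then h.choose else a
  have hout_eq : ∀ a b, b ≠ a → (∃ y ∈ S b, D.Adj (r a) y) → out a = b := by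
    intro a b hab hb
    have hex : ∃ b, b ≠ a ∧ ∃ y ∈ S b, D.Adj (r a) y := ⟨b, hab, hb⟩
    have hoa : out a = hex.choose := dif_pos hex
    obtain ⟨hca, z, hz, hrz⟩ := hex.choose_spec
    rw [← hoa] at hca hz
    obtain ⟨y, hy, hry⟩ := hb
    by_contra hne
    have hyz : z ≠ y := (hS.disjoint _ _ hne).ne_of_mem hz hy
    refine hH a (out a) b (hout _ _ hca.symm z hz hrz) (hout _ _ hab.symm y hy hry)
      ((hS.adj_iff _ _ hne).2 ⟨z, hz, y, hy, (hD.isOrientation.adj_iff _ _).2 ?_⟩)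
    exact (hD.tournament _ z y hrz hry hyz).imp And.left And.left
  have hsub : H.edgeFinset ⊆ Finset.univ.image fun a => s(a, out a) := by
    intro e
    induction e with
    | _ a b =>
      intro he
      rw [mem_edgeFinset, mem_edgeSet] at he
      obtain ⟨x, hx, y, hy, hxy⟩ := (hS.adj_iff a b he.ne).1 he
      rw [Finset.mem_image]
      rcases hD.root_adj (hS.disjoint a b he.ne) hx hy (hroot a x hx) (hroot b y hy) hxy with h | h
      · exact ⟨a, Finset.mem_univ _, by rw [hout_eq a b he.ne' h]⟩
      · exact ⟨b, Finset.mem_univ _, by rw [hout_eq b a he.ne h, Sym2.eq_swap]⟩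
  exact (Finset.card_le_card hsub).trans Finset.card_image_le

instance : DecidableRel (completeBipartiteGraph (Fin 2) (Fin 3)).Adj := fun _ _ =>
  inferInstanceAs (Decidable (_ ∨ _))

theorem OnePerfectlyOrientable.inducedMinorFree_completeBipartiteGraph [Finite V]
    (hG : G.OnePerfectlyOrientable) :
    G.InducedMinorFree (completeBipartiteGraph (Fin 2) (Fin 3)) := by
  rintro ⟨S, hS⟩
  have h := hG.card_edgeFinset_le (by
    rintro (a | a) (b | b) (c | c) <;> simp) hS
  revert h
  decide

theorem domino_adj {a b : Fin 6} : domino.Adj a b ↔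
    (s(a, b) ∈ ({s(0, 1), s(1, 3), s(3, 2), s(2, 0), s(1, 5), s(5, 4), s(4, 0)} :
      Finset (Sym2 (Fin 6)))) ∧ a ≠ b := by
  simp [domino, fromEdgeSet_adj]

instance : DecidableRel domino.Adj := fun _ _ => decidable_of_iff' _ domino_adj

theorem OnePerfectlyOrientable.inducedMinorFree_domino [Finite V]
    (hG : G.OnePerfectlyOrientable) : G.InducedMinorFree domino := by
  rintro ⟨S, hS⟩
  have h := hG.card_edgeFinset_le (by decide) hS
  revert h
  decide

/-! ### Induced cycles -/

/-- `f 0, …, f (n - 1)` are the distinct vertices, in cyclic order, of an induced cycle of `G`;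
values of `f` at arguments `≥ n` play no role. For `n ≥ 3` this amounts to an embedding of
`cycleGraph n`. -/
structure IsInducedCycle (G : SimpleGraph V) (n : ℕ) (f : ℕ → V) : Prop where
  inj : ∀ i < n, ∀ j < n, f i = f j → i = j
  adj_iff : ∀ i j, i < j → j < n → (G.Adj (f i) (f j) ↔ j = i + 1 ∨ i = 0 ∧ j + 1 = n)

theorem cycleGraph_adj_of_lt {n : ℕ} {u v : Fin n} (h : u < v) :
    (cycleGraph n).Adj u v ↔ v.val = u.val + 1 ∨ u.val = 0 ∧ v.val + 1 = n := by
  rw [cycleGraph_adj', Fin.sub_val_of_le h.le, Fin.coe_sub_iff_lt.2 h]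
  have := v.2
  have : u.val < v.val := h
  omega

theorem isInducedCycle_of_embedding {n : ℕ} (hn : 0 < n) (e : cycleGraph n ↪g G) :
    G.IsInducedCycle n fun i => e ⟨i % n, Nat.mod_lt _ hn⟩ where
  inj i hi j hj h := by
    have := e.injective h
    simpa [Nat.mod_eq_of_lt, hi, hj] using this
  adj_iff i j hij hj := by
    rw [e.map_adj_iff, cycleGraph_adj_of_lt]
    · simp [Nat.mod_eq_of_lt, hij.trans hj, hj]
    · simpa [Nat.mod_eq_of_lt, hij.trans hj, hj] using hij

theorem image_Ico_add_one (f : ℕ → V) (a : ℕ) : f '' Set.Ico a (a + 1) = {f a} := by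
  have : Set.Ico a (a + 1) = {a} := by
    ext i
    simp only [Set.mem_Ico, Set.mem_singleton_iff]
    omega
  rw [this, Set.image_singleton]

namespace IsInducedCycle

variable {n : ℕ} {f : ℕ → V}

/-- The embedding of the cycle graph given by an induced cycle. -/
def embedding (h : G.IsInducedCycle n f) : cycleGraph n ↪g G where
  toFun i := f i
  inj' i j hij := Fin.ext (h.inj i i.2 j j.2 hij)
  map_rel_iff' {i j} := by
    change G.Adj (f i) (f j) ↔ _
    rcases lt_trichotomy i j with hij | rfl | hij
    · rw [cycleGraph_adj_of_lt hij, h.adj_iff _ _ hij j.2]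
    · simp
    · rw [G.adj_comm, (cycleGraph n).adj_comm, cycleGraph_adj_of_lt hij, h.adj_iff _ _ hij i.2]

theorem rotate (h : G.IsInducedCycle n f) {k : ℕ} (hk : k < n) :
    G.IsInducedCycle n fun i => f (if i + k < n then i + k else i + k - n) where
  inj i hi j hj hij := by
    have := h.inj _ (by split_ifs <;> omega) _ (by split_ifs <;> omega) hij
    split_ifs at this <;> omega
  adj_iff i j hij hj := by
    by_cases h1 : j + k < n
    · rw [if_pos h1, if_pos (by omega), h.adj_iff _ _ (by omega) h1]
      omega
    · by_cases h2 : i + k < n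
      · rw [if_neg h1, if_pos h2, G.adj_comm, h.adj_iff _ _ (by omega) h2]
        omega
      · rw [if_neg h1, if_neg h2, h.adj_iff _ _ (by omega) (by omega)]
        omega

theorem exists_rotate (h : G.IsInducedCycle n f) {x : V} (hx : x ∈ f '' Set.Iio n) :
    ∃ g, G.IsInducedCycle n g ∧ g 0 = x ∧ g '' Set.Iio n = f '' Set.Iio n := by
  obtain ⟨k, hk, rfl⟩ := hx
  rw [Set.mem_Iio] at hk
  refine ⟨_, h.rotate hk, by simp [hk], ?_⟩
  ext v
  simp only [Set.mem_image, Set.mem_Iio]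
  constructor
  · rintro ⟨i, hi, rfl⟩
    exact ⟨_, by split_ifs <;> omega, rfl⟩
  · rintro ⟨i, hi, rfl⟩
    by_cases hki : k ≤ i
    · exact ⟨i - k, by omega, by rw [if_pos (by omega)]; congr; omega⟩
    · exact ⟨i + n - k, by omega, by rw [if_neg (by omega)]; congr; omega⟩

theorem adj_succ (h : G.IsInducedCycle n f) {i : ℕ} (hi : i + 1 < n) : G.Adj (f i) (f (i + 1)) :=
  (h.adj_iff _ _ (by omega) hi).2 (.inl rfl)

theorem adj_zero_last (h : G.IsInducedCycle n f) (hn : 1 < n) : G.Adj (f 0) (f (n - 1)) :=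
  (h.adj_iff _ _ (by omega) (by omega)).2 (.inr ⟨rfl, by omega⟩)

theorem induce_arc_connected (h : G.IsInducedCycle n f) {a b : ℕ} (hab : a < b) (hb : b ≤ n) :
    (G.induce (f '' Set.Ico a b)).Connected := by
  induction b, hab using Nat.le_induction with
  | base => exact image_Ico_add_one f a ▸ induce_singleton_connected (f a)
  | succ b hab ih =>
    rw [← Set.insert_Ico_right_eq_Ico_add_one (by omega), Set.image_insert_eq]
    refine induce_insert_connected (ih (by omega)) (s := f (b - 1)) ⟨b - 1, ?_, rfl⟩ ?_
    · constructor <;> omega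
    · have := h.adj_succ (i := b - 1) (by omega)
      rwa [Nat.sub_add_cancel (by omega)] at this

theorem disjoint_arcs (h : G.IsInducedCycle n f) {a b c d : ℕ} (hbc : b ≤ c)
    (hd : d ≤ n) : Disjoint (f '' Set.Ico a b) (f '' Set.Ico c d) := by
  rw [Set.disjoint_left]
  rintro _ ⟨i, ⟨hi, hi'⟩, rfl⟩ ⟨j, ⟨hj, hj'⟩, hij⟩
  have := h.inj j (by omega) i (by omega) hij
  omega

end IsInducedCycle

theorem isMinorModel_of_lt [LinearOrder W] {H : SimpleGraph W} {S : W → Set V}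
    (hd : ∀ u v, u < v → Disjoint (S u) (S v)) (hc : ∀ v, (G.induce (S v)).Connected)
    (ha : ∀ u v, u < v → H.Adj u v → ∃ x ∈ S u, ∃ y ∈ S v, G.Adj x y) :
    G.IsMinorModel H S where
  disjoint u v huv := huv.lt_or_gt.elim (hd u v) fun h => (hd v u h).symm
  connected := hc
  adj u v huv := by
    rcases huv.ne.lt_or_gt with h | h
    · exact ha u v h huv
    · obtain ⟨x, hx, y, hy, hxy⟩ := ha v u h huv.symm
      exact ⟨y, hy, x, hx, hxy.symm⟩

theorem isInducedMinorModel_of_lt [LinearOrder W] {H : SimpleGraph W} {S : W → Set V}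
    (hd : ∀ u v, u < v → Disjoint (S u) (S v)) (hc : ∀ v, (G.induce (S v)).Connected)
    (ha : ∀ u v, u < v → (H.Adj u v ↔ ∃ x ∈ S u, ∃ y ∈ S v, G.Adj x y)) :
    G.IsInducedMinorModel H S where
  disjoint u v huv := huv.lt_or_gt.elim (hd u v) fun h => (hd v u h).symm
  connected := hc
  adj_iff u v huv := by
    rcases huv.lt_or_gt with h | h
    · exact ha u v h
    · rw [H.adj_comm, ha v u h]
      exact ⟨fun ⟨x, hx, y, hy, hxy⟩ => ⟨y, hy, x, hx, hxy.symm⟩,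
        fun ⟨x, hx, y, hy, hxy⟩ => ⟨y, hy, x, hx, hxy.symm⟩⟩

/-- A connected set with neighbors at three vertices of a cycle yields a `K₄` minor: the cycle is
cut into three arcs, each starting at one of these vertices. -/
theorem IsInducedCycle.not_minorFree_of_three {n : ℕ} {f : ℕ → V} (h : G.IsInducedCycle n f)
    {K : Set V} (hK : (G.induce K).Connected) (hdisj : Disjoint K (f '' Set.Iio n)) {x y z : V}
    (hx : x ∈ f '' Set.Iio n) (hy : y ∈ f '' Set.Iio n) (hz : z ∈ f '' Set.Iio n)
    (hxy : x ≠ y) (hxz : x ≠ z) (hyz : y ≠ z) (hKx : ∃ k ∈ K, G.Adj k x) (hKy : ∃ k ∈ K, G.Adj k y)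
    (hKz : ∃ k ∈ K, G.Adj k z) : ¬ G.MinorFree (completeGraph (Fin 4)) := by
  obtain ⟨g, hg, rfl, hgf⟩ := h.exists_rotate hx
  rw [← hgf] at hdisj hy hz
  obtain ⟨i, hi, rfl⟩ := hy
  obtain ⟨j, hj, rfl⟩ := hz
  wlog hij : i < j generalizing i j
  · refine this j hj hKz hxz i hi hKy hxy hyz.symm (lt_of_le_of_ne (not_lt.1 hij) ?_)
    rintro rfl
    exact hyz rfl
  rw [Set.mem_Iio] at hi hj
  have hi0 : 0 < i := Nat.pos_of_ne_zero fun h => hxy (h ▸ rfl)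
  have hKd : ∀ a b, b ≤ n → Disjoint K (g '' Set.Ico a b) := fun a b hb =>
    hdisj.mono_right (Set.image_mono fun k hk => hk.2.trans_le hb)
  refine fun hfree => hfree ⟨![K, g '' Set.Ico 0 i, g '' Set.Ico i j, g '' Set.Ico j n],
    isMinorModel_of_lt ?_ ?_ ?_⟩
  · intro u v huv
    fin_cases u <;> fin_cases v <;> first | exact absurd huv (by decide) | skip
    · exact hKd _ _ (by omega)
    · exact hKd _ _ (by omega)
    · exact hKd _ _ (by omega)
    · exact hg.disjoint_arcs le_rfl (by omega)
    · exact hg.disjoint_arcs hij.le (by omega)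
    · exact hg.disjoint_arcs le_rfl (by omega)
  · intro v
    fin_cases v
    · exact hK
    · exact hg.induce_arc_connected hi0 (by omega)
    · exact hg.induce_arc_connected hij (by omega)
    · exact hg.induce_arc_connected hj le_rfl
  · intro u v huv _
    have hmem : ∀ a b k, a ≤ k → k < b → g k ∈ g '' Set.Ico a b := fun a b k h1 h2 =>
      ⟨k, ⟨h1, h2⟩, rfl⟩
    fin_cases u <;> fin_cases v <;> first | exact absurd huv (by decide) | skip
    · obtain ⟨k, hk, hadj⟩ := hKx
      exact ⟨k, hk, g 0, hmem _ _ _ le_rfl hi0, hadj⟩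
    · obtain ⟨k, hk, hadj⟩ := hKy
      exact ⟨k, hk, g i, hmem _ _ _ le_rfl hij, hadj⟩
    · obtain ⟨k, hk, hadj⟩ := hKz
      exact ⟨k, hk, g j, hmem _ _ _ le_rfl hj, hadj⟩
    · refine ⟨g (i - 1), hmem _ _ _ (by omega) (by omega), g i, hmem _ _ _ le_rfl hij, ?_⟩
      simpa [Nat.sub_add_cancel hi0] using hg.adj_succ (i := i - 1) (by omega)
    · exact ⟨g 0, hmem _ _ _ le_rfl hi0, g (n - 1), hmem _ _ _ (by omega) (by omega),
        hg.adj_zero_last (by omega)⟩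
    · refine ⟨g (j - 1), hmem _ _ _ (by omega) (by omega), g j, hmem _ _ _ le_rfl hj, ?_⟩
      simpa [Nat.sub_add_cancel (hi0.trans hij)] using hg.adj_succ (i := j - 1) (by omega)

/-- A connected set whose neighbors on an induced cycle are two nonadjacent vertices yields an
induced minor `K_{2,3}`: the other three branch sets are that set and the two open arcs. -/
theorem IsInducedCycle.not_inducedMinorFree_of_two {n : ℕ} {f : ℕ → V} (h : G.IsInducedCycle n f)
    {K : Set V} (hK : (G.induce K).Connected) (hdisj : Disjoint K (f '' Set.Iio n)) {x y : V}
    (hx : x ∈ f '' Set.Iio n) (hy : y ∈ f '' Set.Iio n) (hxy : x ≠ y) (hnadj : ¬ G.Adj x y)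
    (hKx : ∃ k ∈ K, G.Adj k x) (hKy : ∃ k ∈ K, G.Adj k y)
    (hK2 : ∀ z ∈ f '' Set.Iio n, (∃ k ∈ K, G.Adj k z) → z = x ∨ z = y) :
    ¬ G.InducedMinorFree (completeBipartiteGraph (Fin 2) (Fin 3)) := by
  obtain ⟨g, hg, rfl, hgf⟩ := h.exists_rotate hx
  rw [← hgf] at hdisj hy hK2
  obtain ⟨i, hi, rfl⟩ := hy
  rw [Set.mem_Iio] at hi
  have hi0 : 0 < i := Nat.pos_of_ne_zero fun h => hxy (h ▸ rfl)
  rw [hg.adj_iff 0 i hi0 hi] at hnadj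
  have hi2 : 1 < i := by omega
  have hin : i + 1 < n := by omega
  have hmem : ∀ a b k, a ≤ k → k < b → g k ∈ g '' Set.Ico a b := fun a b k h1 h2 =>
    ⟨k, ⟨h1, h2⟩, rfl⟩
  have hsing : ∀ a, {g a} = g '' Set.Ico a (a + 1) := fun a => (image_Ico_add_one g a).symm
  have hKd : ∀ a b, b ≤ n → Disjoint K (g '' Set.Ico a b) := fun a b hb =>
    hdisj.mono_right (Set.image_mono fun k hk => hk.2.trans_le hb)
  have hKarc : ∀ a b, b ≤ n → 0 < a → (b ≤ i ∨ i < a) →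
      ∀ k ∈ K, ∀ v ∈ g '' Set.Ico a b, ¬ G.Adj k v := by
    rintro a b hb ha hia k hk _ ⟨j, ⟨hj, hj'⟩, rfl⟩ hadj
    rcases hK2 _ ⟨j, hj'.trans_le hb, rfl⟩ ⟨k, hk, hadj⟩ with h | h
    · have := hg.inj _ (by omega) _ (by omega) h
      omega
    · have := hg.inj _ (by omega) _ (by omega) h
      omega
  have harc : ∀ u ∈ g '' Set.Ico 1 i, ∀ v ∈ g '' Set.Ico (i + 1) n, ¬ G.Adj u v := by
    rintro _ ⟨a, ⟨ha, ha'⟩, rfl⟩ _ ⟨b, ⟨hb, hb'⟩, rfl⟩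
    rw [hg.adj_iff _ _ (by omega) hb']
    omega
  have hxyadj : ∀ u ∈ ({g 0} : Set V), ∀ v ∈ ({g i} : Set V), ¬ G.Adj u v := by
    rintro _ rfl _ rfl
    rwa [hg.adj_iff 0 i hi0 hi]
  let R : Fin 3 → Set V := ![K, g '' Set.Ico 1 i, g '' Set.Ico (i + 1) n]
  let L : Fin 2 → Set V := ![{g 0}, {g i}]
  have hRd : ∀ u v, u ≠ v → Disjoint (R u) (R v) := by
    have h1 := hKd 1 i (by omega)
    have h2 := hKd (i + 1) n le_rfl
    have h3 : Disjoint (g '' Set.Ico 1 i) (g '' Set.Ico (i + 1) n) :=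
      hg.disjoint_arcs (by omega) le_rfl
    intro u v huv
    fin_cases u <;> fin_cases v <;> first | exact absurd rfl huv | skip
    exacts [h1, h2, h1.symm, h3, h2.symm, h3.symm]
  have hLd : ∀ u v, u ≠ v → Disjoint (L u) (L v) := by
    intro u v huv
    fin_cases u <;> fin_cases v <;> first | exact absurd rfl huv | skip
    exacts [Set.disjoint_singleton.2 hxy, Set.disjoint_singleton.2 hxy.symm]
  have hLR : ∀ u v, Disjoint (L u) (R v) := by
    intro u v
    fin_cases u <;> fin_cases v <;> simp only [L, R] <;> dsimp <;> rw [hsing]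
    · exact (hKd _ _ (by omega)).symm
    · exact hg.disjoint_arcs (by omega) (by omega)
    · exact hg.disjoint_arcs (by omega) (by omega)
    · exact (hKd _ _ (by omega)).symm
    · exact (hg.disjoint_arcs (by omega) (by omega)).symm
    · exact hg.disjoint_arcs (by omega) (by omega)
  have hRadj : ∀ u v, u ≠ v → ∀ a ∈ R u, ∀ b ∈ R v, ¬ G.Adj a b := by
    have h1 := hKarc 1 i (by omega) (by omega) (by omega)
    have h2 := hKarc (i + 1) n (by omega) (by omega) (by omega)
    intro u v huv a ha b hb hab
    fin_cases u <;> fin_cases v <;> first | exact absurd rfl huv | skip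
    exacts [h1 a ha b hb hab, h2 a ha b hb hab, h1 b hb a ha hab.symm, harc a ha b hb hab,
      h2 b hb a ha hab.symm, harc b hb a ha hab.symm]
  have hLadj : ∀ u v, u ≠ v → ∀ a ∈ L u, ∀ b ∈ L v, ¬ G.Adj a b := by
    intro u v huv a ha b hb hab
    fin_cases u <;> fin_cases v <;> first | exact absurd rfl huv | skip
    exacts [hxyadj a ha b hb hab, hxyadj b hb a ha hab.symm]
  have hLRadj : ∀ u v, ∃ a ∈ L u, ∃ b ∈ R v, G.Adj a b := by
    intro u v
    fin_cases u <;> fin_cases v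
    · obtain ⟨k, hk, hadj⟩ := hKx
      exact ⟨g 0, rfl, k, hk, hadj.symm⟩
    · exact ⟨g 0, rfl, g 1, hmem _ _ _ le_rfl hi2, hg.adj_succ (by omega)⟩
    · exact ⟨g 0, rfl, g (n - 1), hmem _ _ _ (by omega) (by omega), hg.adj_zero_last (by omega)⟩
    · obtain ⟨k, hk, hadj⟩ := hKy
      exact ⟨g i, rfl, k, hk, hadj.symm⟩
    · refine ⟨g i, rfl, g (i - 1), hmem _ _ _ (by omega) (by omega), ?_⟩
      simpa [Nat.sub_add_cancel hi0] using (hg.adj_succ (i := i - 1) (by omega)).symm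
    · exact ⟨g i, rfl, g (i + 1), hmem _ _ _ le_rfl hin, hg.adj_succ hin⟩
  refine fun hfree => hfree ⟨Sum.elim L R, ⟨?_, ?_, ?_⟩⟩
  · rintro (u | u) (v | v) huv
    · exact hLd u v fun h => huv (h ▸ rfl)
    · exact hLR u v
    · exact (hLR v u).symm
    · exact hRd u v fun h => huv (h ▸ rfl)
  · rintro (u | u)
    · fin_cases u <;> exact induce_singleton_connected _
    · fin_cases u
      · exact hK
      · exact hg.induce_arc_connected hi2 (by omega)
      · exact hg.induce_arc_connected hin le_rfl
  · rintro (u | u) (v | v) huv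
    · refine iff_of_false (by simp) ?_
      rintro ⟨a, ha, b, hb, hab⟩
      exact hLadj u v (fun h => huv (h ▸ rfl)) a ha b hb hab
    · exact iff_of_true (by simp) (hLRadj u v)
    · obtain ⟨a, ha, b, hb, hab⟩ := hLRadj v u
      exact iff_of_true (by simp) ⟨b, hb, a, ha, hab.symm⟩
    · refine iff_of_false (by simp) ?_
      rintro ⟨a, ha, b, hb, hab⟩
      exact hRadj u v (fun h => huv (h ▸ rfl)) a ha b hb hab

/-! ### Two squares glued along an edge -/

/-- `S` is an induced minor model in `G` of a 4-cycle, with `x` and `y` in the branch sets of two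
consecutive vertices. -/
structure IsRootedSquare (G : SimpleGraph V) (x y : V) (S : Fin 4 → Set V) : Prop where
  model : G.IsInducedMinorModel (cycleGraph 4) S
  left_mem : x ∈ S 0
  right_mem : y ∈ S 1

theorem IsRootedSquare.map {G' : SimpleGraph W} {x y : W} {S : Fin 4 → Set W}
    (h : G'.IsRootedSquare x y S) (e : G' ↪g G) :
    G.IsRootedSquare (e x) (e y) fun i => e '' S i :=
  ⟨h.model.map e, ⟨x, h.left_mem, rfl⟩, ⟨y, h.right_mem, rfl⟩⟩

instance {n : ℕ} : DecidableRel (cycleGraph n).Adj := fun _ _ => decidable_of_iff' _ cycleGraph_adj'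

theorem IsRootedSquare.symm {x y : V} {S : Fin 4 → Set V} (h : G.IsRootedSquare x y S) :
    G.IsRootedSquare y x fun i => S (1 - i) where
  model :=
    { disjoint := fun u v huv => h.model.disjoint _ _ fun h => huv (sub_right_injective h)
      connected := fun v => h.model.connected _
      adj_iff := fun u v huv => by
        rw [← h.model.adj_iff _ _ fun h => huv (sub_right_injective h)]
        revert u v
        decide }
  left_mem := h.right_mem
  right_mem := h.left_mem

/-- Two rooted squares whose supports `T` and `T'` meet exactly in the roots `x` and `y`, with no
other edges between `T` and `T'`, form a domino: the branch sets of the roots are united. -/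
theorem not_inducedMinorFree_domino {x y : V} {S S' : Fin 4 → Set V} {T T' : Set V}
    (hS : G.IsRootedSquare x y S) (hS' : G.IsRootedSquare x y S') (hT : ∀ i, S i ⊆ T)
    (hT' : ∀ i, S' i ⊆ T') (hTT : ∀ v ∈ T, v ∈ T' → v = x ∨ v = y)
    (hadj : ∀ u ∈ T, ∀ v ∈ T', G.Adj u v → u ∈ T' ∨ v ∈ T) : ¬ G.InducedMinorFree domino := by
  have hx := hT 0 hS.left_mem
  have hy := hT 1 hS.right_mem
  have hx' := hT' 0 hS'.left_mem
  have hy' := hT' 1 hS'.right_mem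
  -- `0` and `1` are the common vertices of the two squares of the domino; `σ` and `τ` number the
  -- vertices of each square along `cycleGraph 4`, and are `none` off it. The branch sets `P` are
  -- such that `P i` meets `T` in `S (σ i)` and `T'` in `S' (τ i)`.
  let σ : Fin 6 → Option (Fin 4) := ![some 0, some 1, some 3, some 2, none, none]
  let τ : Fin 6 → Option (Fin 4) := ![some 0, some 1, none, none, some 3, some 2]
  let P : Fin 6 → Set V := fun i => {v | (∃ a ∈ σ i, v ∈ S a) ∨ ∃ a ∈ τ i, v ∈ S' a}
  have hP : ∀ i, ∀ v ∈ P i, v ∈ T → ∃ a ∈ σ i, v ∈ S a := by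
    rintro i v (h | ⟨a, ha, hv⟩) hvT
    · exact h
    · rcases hTT v hvT (hT' a hv) with rfl | rfl
      · have ha0 : a = 0 := by
          by_contra hne
          exact (hS'.model.disjoint a 0 hne).ne_of_mem hv hS'.left_mem rfl
        subst ha0
        exact ⟨0, by revert ha; revert i; decide, hS.left_mem⟩
      · have ha0 : a = 1 := by
          by_contra hne
          exact (hS'.model.disjoint a 1 hne).ne_of_mem hv hS'.right_mem rfl
        subst ha0
        exact ⟨1, by revert ha; revert i; decide, hS.right_mem⟩
  have hP' : ∀ i, ∀ v ∈ P i, v ∈ T' → ∃ a ∈ τ i, v ∈ S' a := by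
    rintro i v (⟨a, ha, hv⟩ | h) hvT
    · rcases hTT v (hT a hv) hvT with rfl | rfl
      · have ha0 : a = 0 := by
          by_contra hne
          exact (hS.model.disjoint a 0 hne).ne_of_mem hv hS.left_mem rfl
        subst ha0
        exact ⟨0, by revert ha; revert i; decide, hS'.left_mem⟩
      · have ha0 : a = 1 := by
          by_contra hne
          exact (hS.model.disjoint a 1 hne).ne_of_mem hv hS.right_mem rfl
        subst ha0
        exact ⟨1, by revert ha; revert i; decide, hS'.right_mem⟩
    · exact h
  have hPT : ∀ i, ∀ v ∈ P i, v ∈ T ∨ v ∈ T' := by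
    rintro i v (⟨a, -, hv⟩ | ⟨a, -, hv⟩)
    exacts [.inl (hT a hv), .inr (hT' a hv)]
  have hσ : ∀ i j, i ≠ j → ∀ a ∈ σ i, ∀ b ∈ σ j, a ≠ b := by decide
  have hτ : ∀ i j, i ≠ j → ∀ a ∈ τ i, ∀ b ∈ τ j, a ≠ b := by decide
  have hdom : ∀ i j, i ≠ j → (domino.Adj i j ↔
      (∃ a ∈ σ i, ∃ b ∈ σ j, (cycleGraph 4).Adj a b) ∨
        ∃ a ∈ τ i, ∃ b ∈ τ j, (cycleGraph 4).Adj a b) := by decide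
  refine fun hfree => hfree ⟨P, ⟨?_, ?_, ?_⟩⟩
  · intro i j hij
    rw [Set.disjoint_left]
    intro v hi hj
    rcases hPT i v hi with h | h
    · obtain ⟨a, ha, hva⟩ := hP i v hi h
      obtain ⟨b, hb, hvb⟩ := hP j v hj h
      exact (hS.model.disjoint a b (hσ i j hij a ha b hb)).ne_of_mem hva hvb rfl
    · obtain ⟨a, ha, hva⟩ := hP' i v hi h
      obtain ⟨b, hb, hvb⟩ := hP' j v hj h
      exact (hS'.model.disjoint a b (hτ i j hij a ha b hb)).ne_of_mem hva hvb rfl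
  · intro i
    have hunion : ∀ a, (S a ∩ S' a).Nonempty → (G.induce (S a ∪ S' a)).Connected := fun a ha =>
      induce_union_connected (hS.model.connected a).preconnected
        (hS'.model.connected a).preconnected ha
    have key : ∀ A, (∀ v, ((∃ a ∈ σ i, v ∈ S a) ∨ ∃ a ∈ τ i, v ∈ S' a) ↔ v ∈ A) →
        (G.induce A).Connected → (G.induce (P i)).Connected := fun A hA hconn => by
      rwa [show P i = A from Set.ext hA]
    fin_cases i
    · exact key _ (by simp [σ, τ]) (hunion 0 ⟨x, hS.left_mem, hS'.left_mem⟩)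
    · exact key _ (by simp [σ, τ]) (hunion 1 ⟨y, hS.right_mem, hS'.right_mem⟩)
    · exact key _ (by simp [σ, τ]) (hS.model.connected 3)
    · exact key _ (by simp [σ, τ]) (hS.model.connected 2)
    · exact key _ (by simp [σ, τ]) (hS'.model.connected 3)
    · exact key _ (by simp [σ, τ]) (hS'.model.connected 2)
  · intro i j hij
    rw [hdom i j hij]
    constructor
    · rintro (⟨a, ha, b, hb, hab⟩ | ⟨a, ha, b, hb, hab⟩)
      · obtain ⟨u, hu, v, hv, huv⟩ := (hS.model.adj_iff a b hab.ne).1 hab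
        exact ⟨u, .inl ⟨a, ha, hu⟩, v, .inl ⟨b, hb, hv⟩, huv⟩
      · obtain ⟨u, hu, v, hv, huv⟩ := (hS'.model.adj_iff a b hab.ne).1 hab
        exact ⟨u, .inr ⟨a, ha, hu⟩, v, .inr ⟨b, hb, hv⟩, huv⟩
    · rintro ⟨u, hu, v, hv, huv⟩
      have : (u ∈ T ∧ v ∈ T) ∨ (u ∈ T' ∧ v ∈ T') := by
        rcases hPT i u hu with h1 | h1 <;> rcases hPT j v hv with h2 | h2
        · exact .inl ⟨h1, h2⟩
        · exact (hadj u h1 v h2 huv).elim (fun h => .inr ⟨h, h2⟩) fun h => .inl ⟨h1, h⟩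
        · exact (hadj v h2 u h1 huv.symm).elim (fun h => .inr ⟨h1, h⟩) fun h => .inl ⟨h, h2⟩
        · exact .inr ⟨h1, h2⟩
      rcases this with ⟨h1, h2⟩ | ⟨h1, h2⟩
      · obtain ⟨a, ha, hua⟩ := hP i u hu h1
        obtain ⟨b, hb, hvb⟩ := hP j v hv h2
        exact .inl ⟨a, ha, b, hb,
          (hS.model.adj_iff a b (hσ i j hij a ha b hb)).2 ⟨u, hua, v, hvb, huv⟩⟩
      · obtain ⟨a, ha, hua⟩ := hP' i u hu h1
        obtain ⟨b, hb, hvb⟩ := hP' j v hv h2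
        exact .inr ⟨a, ha, b, hb,
          (hS'.model.adj_iff a b (hτ i j hij a ha b hb)).2 ⟨u, hua, v, hvb, huv⟩⟩

/-- Along an edge `x y` of an induced cycle of length at least four, the branch sets are `x`, `y`,
the other neighbor of `y`, and the remaining arc. -/
theorem IsInducedCycle.exists_isRootedSquare {n : ℕ} {f : ℕ → V} (h : G.IsInducedCycle n f)
    (hn : 4 ≤ n) {x y : V} (hx : x ∈ f '' Set.Iio n) (hy : y ∈ f '' Set.Iio n) (hxy : G.Adj x y) :
    ∃ S : Fin 4 → Set V, G.IsRootedSquare x y S ∧ ∀ i, S i ⊆ f '' Set.Iio n := by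
  -- After a rotation starting at `x` the vertex `y` comes second or last; in the latter case the
  -- roles of `x` and `y` are exchanged and the cycle is rotated to start at `y`.
  have key : ∀ g, G.IsInducedCycle n g → ∃ S : Fin 4 → Set V, G.IsRootedSquare (g 0) (g 1) S ∧
      ∀ i, S i ⊆ g '' Set.Iio n := by
    intro g hg
    have hmem : ∀ a b k, a ≤ k → k < b → g k ∈ g '' Set.Ico a b := fun a b k h1 h2 =>
      ⟨k, ⟨h1, h2⟩, rfl⟩
    refine ⟨![g '' Set.Ico 0 1, g '' Set.Ico 1 2, g '' Set.Ico 2 3, g '' Set.Ico 3 n],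
      ⟨isInducedMinorModel_of_lt ?_ ?_ ?_, hmem _ _ _ le_rfl (by omega),
        hmem _ _ _ le_rfl (by omega)⟩, ?_⟩
    · intro u v huv
      fin_cases u <;> fin_cases v <;> first | exact absurd huv (by decide) | skip
      all_goals exact hg.disjoint_arcs (by omega) (by omega)
    · intro v
      fin_cases v <;> exact hg.induce_arc_connected (by omega) (by omega)
    · have hyes : ∀ a b c d i j, (a ≤ i ∧ i < b) → (c ≤ j ∧ j < d) → G.Adj (g i) (g j) →
          ∃ x ∈ g '' Set.Ico a b, ∃ y ∈ g '' Set.Ico c d, G.Adj x y :=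
        fun a b c d i j hi hj hij => ⟨_, ⟨i, hi, rfl⟩, _, ⟨j, hj, rfl⟩, hij⟩
      have hno : ∀ a b c d, b < c → d ≤ n → (0 < a ∨ d < n) →
          ¬ ∃ x ∈ g '' Set.Ico a b, ∃ y ∈ g '' Set.Ico c d, G.Adj x y := by
        rintro a b c d hbc hd h0 ⟨_, ⟨i, ⟨hi, hi'⟩, rfl⟩, _, ⟨j, ⟨hj, hj'⟩, rfl⟩, hij⟩
        rw [hg.adj_iff _ _ (by omega) (by omega)] at hij
        omega
      intro u v huv
      fin_cases u <;> fin_cases v <;> first | exact absurd huv (by decide) | skip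
      · exact iff_of_true (by decide)
          (hyes _ _ _ _ 0 1 (by omega) (by omega) (hg.adj_succ (by omega)))
      · exact iff_of_false (by decide) (hno _ _ _ _ (by omega) (by omega) (by omega))
      · exact iff_of_true (by decide)
          (hyes _ _ _ _ 0 (n - 1) (by omega) (by omega) (hg.adj_zero_last (by omega)))
      · exact iff_of_true (by decide)
          (hyes _ _ _ _ 1 2 (by omega) (by omega) (hg.adj_succ (by omega)))
      · exact iff_of_false (by decide) (hno _ _ _ _ (by omega) (by omega) (by omega))
      · exact iff_of_true (by decide)
          (hyes _ _ _ _ 2 3 (by omega) (by omega) (hg.adj_succ (by omega)))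
    · intro i
      fin_cases i <;> exact Set.image_mono fun k hk => Set.mem_Iio.2 (by
        have := hk.2; omega)
  obtain ⟨g, hg, rfl, hgf⟩ := h.exists_rotate hx
  rw [← hgf] at hy ⊢
  obtain ⟨j, hj, rfl⟩ := hy
  rw [Set.mem_Iio] at hj
  have hj0 : 0 < j := Nat.pos_of_ne_zero fun h => hxy.ne (h ▸ rfl)
  rcases (hg.adj_iff 0 j hj0 hj).1 hxy with rfl | ⟨-, hjn⟩
  · exact key g hg
  · obtain ⟨S, hS, hSg⟩ := key _ (hg.rotate hj)
    simp only [zero_add, if_pos hj, if_neg (show ¬ 1 + j < n by omega),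
      show 1 + j - n = 0 by omega] at hS
    refine ⟨_, hS.symm, fun i => (hSg _).trans ?_⟩
    rintro _ ⟨k, hk, rfl⟩
    rw [Set.mem_Iio] at hk
    exact ⟨_, by rw [Set.mem_Iio]; split_ifs <;> omega, rfl⟩

/-! ### Graphs built by adding simplicial vertices of degree two -/

theorem isK_iff [Finite V] {n : ℕ} : G.IsK n ↔ Nat.card V = n ∧ G = ⊤ := by
  constructor
  · rintro ⟨e⟩
    refine ⟨by simpa using Nat.card_congr e.toEquiv, ?_⟩
    ext u v
    rw [← e.map_adj_iff]
    simp
  · rintro ⟨h, rfl⟩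
    exact ⟨Iso.completeGraph (Finite.equivFinOfCardEq h)⟩

theorem isK_three_iff : G.IsK 3 ↔ Nonempty (G ≃g cycleGraph 3) := by
  rw [cycleGraph_three_eq_top]
  rfl

/-- The orientation of a cycle along itself. -/
theorem exists_orientation_cycleGraph {n : ℕ} (hn : 3 ≤ n) :
    ∃ D : Digraph (Fin n), (cycleGraph n).IsOnePerfectOrientation D ∧ D.SinkFree := by
  obtain ⟨m, rfl⟩ : ∃ m, n = m + 3 := ⟨n - 3, by omega⟩
  refine ⟨⟨fun v w => w = v + 1⟩, ⟨⟨fun v w => ?_, fun v w h h' => ?_⟩, fun v x y hx hy hxy => ?_⟩,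
    fun v hv => hv (v + 1) rfl⟩
  · rw [cycleGraph_adj, sub_eq_iff_eq_add', sub_eq_iff_eq_add', or_comm]
  · change w = v + 1 at h
    change v = w + 1 at h'
    rw [h, add_assoc, left_eq_add] at h'
    have := congrArg Fin.val h'
    simp only [Fin.val_add, Fin.val_one, Fin.val_zero] at this
    rw [Nat.mod_eq_of_lt (by omega)] at this
    omega
  · exact absurd (Eq.trans hx (Eq.symm hy)) hxy

/-- A new simplicial vertex of degree two becomes a source with two out-neighbors. -/
theorem BuiltFrom.exists_orientation {V : Type u} {G : SimpleGraph V} {n : ℕ} (hn : 3 ≤ n)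
    (h : BuiltFrom (cycleGraph n) G) :
    ∃ D : Digraph V, G.IsOnePerfectOrientation D ∧ D.SinkFree := by
  induction h with
  | base G e =>
    obtain ⟨D, hD, hs⟩ := exists_orientation_cycleGraph hn
    refine ⟨⟨fun v w => D.Adj (e v) (e w)⟩, ⟨⟨fun v w => ?_, fun v w => ?_⟩, fun v x y => ?_⟩,
      fun v hv => hs (e v) fun w => ?_⟩
    · rw [← e.map_adj_iff]
      exact hD.isOrientation.adj_iff _ _
    · exact hD.isOrientation.asymm _ _
    · exact fun hx hy hxy => hD.tournament _ _ _ hx hy (e.injective.ne hxy)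
    · simpa using hv (e.symm w)
  | add G v hv hdeg _ ih =>
    obtain ⟨D, hD, hs⟩ := ih
    have hDG : ∀ a b (ha : a ∈ ({v}ᶜ : Set _)) (hb : b ∈ ({v}ᶜ : Set _)), G.Adj a b ↔
        D.Adj ⟨a, ha⟩ ⟨b, hb⟩ ∨ D.Adj ⟨b, hb⟩ ⟨a, ha⟩ := fun a b ha hb =>
      hD.isOrientation.adj_iff ⟨a, ha⟩ ⟨b, hb⟩
    let D' : Digraph _ := ⟨fun a b => (a = v ∧ G.Adj v b) ∨
      ∃ (ha : a ∈ ({v}ᶜ : Set _)) (hb : b ∈ ({v}ᶜ : Set _)), D.Adj ⟨a, ha⟩ ⟨b, hb⟩⟩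
    have hD'v : ∀ b, D'.Adj v b ↔ G.Adj v b := fun b =>
      ⟨fun h => h.elim And.right fun ⟨ha, _⟩ => absurd rfl ha, fun h => .inl ⟨rfl, h⟩⟩
    have hD'v' : ∀ a, ¬ D'.Adj a v := by
      rintro a (⟨rfl, h⟩ | ⟨-, hb, -⟩)
      exacts [h.ne rfl, hb rfl]
    have hD' : ∀ a b (ha : a ∈ ({v}ᶜ : Set _)) (hb : b ∈ ({v}ᶜ : Set _)),
        D'.Adj a b ↔ D.Adj ⟨a, ha⟩ ⟨b, hb⟩ := fun a b ha hb =>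
      ⟨fun h => h.elim (fun h => absurd h.1 ha) fun ⟨_, _, h⟩ => h, fun h => .inr ⟨ha, hb, h⟩⟩
    have hadj : ∀ a b, G.Adj a b ↔ D'.Adj a b ∨ D'.Adj b a := by
      intro a b
      by_cases ha : a = v
      · subst ha
        simp [hD'v, hD'v']
      by_cases hb : b = v
      · subst hb
        simp [hD'v, hD'v', G.adj_comm]
      rw [hDG a b ha hb, hD' a b ha hb, hD' b a hb ha]
    have hasymm : ∀ a b, D'.Adj a b → ¬ D'.Adj b a := by
      intro a b
      by_cases ha : a = v
      · exact fun _ => ha ▸ hD'v' b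
      by_cases hb : b = v
      · exact fun h => absurd (hb ▸ h) (hD'v' a)
      rw [hD' a b ha hb, hD' b a hb ha]
      exact hD.isOrientation.asymm _ _
    refine ⟨D', ⟨⟨hadj, hasymm⟩, fun a x y hx hy hxy => ?_⟩, fun a hsink => ?_⟩
    · have : D'.Adj x y ∨ D'.Adj y x := by
        rw [← hadj]
        by_cases ha : a = v
        · subst ha
          exact hv ((hD'v x).1 hx) ((hD'v y).1 hy) hxy
        · have hx' : x ≠ v := fun h => hD'v' a (h ▸ hx)
          have hy' : y ≠ v := fun h => hD'v' a (h ▸ hy)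
          rw [hD' a _ ha hx'] at hx
          rw [hD' a _ ha hy'] at hy
          rw [hDG x y hx' hy']
          exact (hD.tournament _ _ _ hx hy fun h => hxy (congrArg Subtype.val h)).imp
            And.left And.left
      exact this.imp (fun h => ⟨h, hasymm _ _ h⟩) fun h => ⟨h, hasymm _ _ h⟩
    · by_cases ha : a = v
      · subst ha
        have : (G.neighborSet a).Nonempty := by
          rw [← Set.ncard_pos (Set.finite_of_ncard_pos (by omega))]
          omega
        obtain ⟨b, hb⟩ := this
        exact hsink b ((hD'v b).2 hb)
      · exact hs ⟨a, ha⟩ fun b hb => hsink b ((hD' a b ha b.2).2 hb)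

theorem BuiltFrom.nonempty_embedding {B : SimpleGraph W} {V : Type u} {G : SimpleGraph V}
    (h : BuiltFrom B G) : Nonempty (B ↪g G) := by
  induction h with
  | base G e => exact ⟨e.symm.toEmbedding⟩
  | add G v _ _ _ ih =>
    obtain ⟨e⟩ := ih
    exact ⟨(Embedding.induce _).comp e⟩

theorem BuiltFrom.trans {V : Type u} {G : SimpleGraph V} {W U : Type*} {B : SimpleGraph W}
    {B' : SimpleGraph U} (h : BuiltFrom B G)
    (hB : ∀ {V : Type u} (G : SimpleGraph V), Nonempty (G ≃g B) → BuiltFrom B' G) :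
    BuiltFrom B' G := by
  induction h with
  | base G e => exact hB G ⟨e⟩
  | add G v hv hdeg _ ih => exact .add G v hv hdeg ih

theorem IsK.isTwoTree_of_three {V : Type u} {G : SimpleGraph V} (h : G.IsK 3) : G.IsTwoTree := by
  have : Finite V := h.elim fun e => Finite.of_equiv _ e.symm.toEquiv
  obtain ⟨hcard, rfl⟩ := isK_iff.1 h
  have hne : Nonempty V := Nat.card_pos_iff.1 (by omega) |>.1
  obtain ⟨v⟩ := hne
  have hc : Nat.card ({v}ᶜ : Set V) = 2 := by
    have := Set.ncard_add_ncard_compl {v}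
    rw [Set.ncard_singleton, hcard] at this
    rw [Nat.card_coe_set_eq]
    omega
  refine .add _ v (fun a _ b _ hab => hab) ?_ (.base _ (isK_iff.2 ⟨hc, ?_⟩).some)
  · have : (⊤ : SimpleGraph V).neighborSet v = {v}ᶜ := by
      ext
      simp [eq_comm]
    rw [this, ← Nat.card_coe_set_eq, hc]
  · ext a b
    simp [Subtype.ext_iff]

theorem isTwoTree_iff [Finite V] : G.IsTwoTree ↔ G.IsK 2 ∨ BuiltFrom (cycleGraph 3) G := by
  constructor
  · intro h
    have key : ∀ {V : Type _} {G : SimpleGraph V}, BuiltFrom (completeGraph (Fin 2)) G →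
        Finite V → G.IsK 2 ∨ BuiltFrom (cycleGraph 3) G := by
      intro V G h
      induction h with
      | base G e => exact fun _ => .inl ⟨e⟩
      | @add V G v hv hdeg _ ih =>
        intro hfin
        rcases ih inferInstance with h | h
        · -- Adding a vertex of degree two to `K₂` gives a triangle.
          refine .inr (.base _ (isK_three_iff.1 (isK_iff.2 ?_)).some)
          obtain ⟨hc, htop⟩ := isK_iff.1 h
          rw [Nat.card_coe_set_eq] at hc
          have hcard := Set.ncard_add_ncard_compl {v}
          rw [Set.ncard_singleton, hc] at hcard
          refine ⟨hcard.symm, ?_⟩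
          have hN : G.neighborSet v = {v}ᶜ :=
            Set.eq_of_subset_of_ncard_le (fun a ha => (G.ne_of_adj ha).symm) (by omega)
          ext a b
          rw [top_adj]
          refine ⟨Adj.ne, fun hab => ?_⟩
          by_cases ha : a = v
          · subst ha
            have : b ∈ G.neighborSet a := hN ▸ hab.symm
            exact this
          by_cases hb : b = v
          · subst hb
            have : a ∈ G.neighborSet b := hN ▸ hab
            exact this.symm
          have : (G.induce {v}ᶜ).Adj ⟨a, ha⟩ ⟨b, hb⟩ := by
            rw [htop]
            exact fun h => hab (congrArg Subtype.val h)
          exact this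
        · exact .inr (.add G v hv hdeg h)
    exact key h inferInstance
  · rintro (⟨⟨e⟩⟩ | h)
    · exact .base _ e
    · exact h.trans fun G hG => (isK_three_iff.2 hG).isTwoTree_of_three

theorem neighborSet_eq_pair_of_ncard_eq_two {v x : V} (hdeg : (G.neighborSet v).ncard = 2)
    (hx : G.Adj v x) : ∃ y, x ≠ y ∧ G.neighborSet v = {x, y} := by
  obtain ⟨a, b, hab, hN⟩ := Set.ncard_eq_two.1 hdeg
  have : x ∈ G.neighborSet v := hx
  rw [hN] at this
  rcases this with rfl | rfl
  · exact ⟨b, hab, hN⟩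
  · exact ⟨a, hab.symm, hN.trans (Set.pair_comm _ _)⟩

/-- If no neighbor of `w ∈ T` lies outside `T`, then `w` is a simplicial vertex of degree two of
`G` when it is one of `G.induce T`. -/
theorem simplicial_of_induce {T : Set V} {w : V} (hw : w ∈ T)
    (hT : ∀ v, G.Adj w v → v ∈ T) (hs : (G.induce T).IsSimplicial ⟨w, hw⟩)
    (hd : ((G.induce T).neighborSet ⟨w, hw⟩).ncard = 2) :
    G.IsSimplicial w ∧ (G.neighborSet w).ncard = 2 := by
  constructor
  · intro a ha b hb hab
    exact hs (show (G.induce T).Adj ⟨w, hw⟩ ⟨a, hT a ha⟩ from ha)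
      (show (G.induce T).Adj ⟨w, hw⟩ ⟨b, hT b hb⟩ from hb) fun h => hab (congrArg Subtype.val h)
  · rw [← hd, ← Set.ncard_image_of_injective _ Subtype.val_injective]
    congr 1
    ext a
    simp only [mem_neighborSet, Set.mem_image, comap_adj, Subtype.exists]
    exact ⟨fun h => ⟨a, hT a h, h, rfl⟩, by rintro ⟨b, _, h, rfl⟩; exact h⟩

/-- A 2-tree other than `K₂` has a simplicial vertex of degree two that avoids a given edge. -/
theorem BuiltFrom.exists_simplicial {V : Type u} {G : SimpleGraph V}
    (h : BuiltFrom (cycleGraph 3) G) {x y : V} (hxy : G.Adj x y) :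
    ∃ w, w ≠ x ∧ w ≠ y ∧ G.IsSimplicial w ∧ (G.neighborSet w).ncard = 2 := by
  induction h with
  | @base V G e =>
    have hK : G.IsK 3 := isK_three_iff.2 ⟨e⟩
    have : Finite V := Finite.of_equiv _ e.symm.toEquiv
    obtain ⟨hcard, rfl⟩ := isK_iff.1 hK
    have hxyc : ({x, y} : Set V).ncard = 2 := Set.ncard_pair hxy.ne
    obtain ⟨w, hw⟩ : ∃ w, w ∉ ({x, y} : Set V) := by
      by_contra! hall
      have : ({x, y} : Set V) = Set.univ := Set.eq_univ_of_forall hall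
      rw [this, Set.ncard_univ] at hxyc
      omega
    have hw' : w ≠ x ∧ w ≠ y := by simpa using hw
    refine ⟨w, hw'.1, hw'.2, fun a _ b _ hab => hab, ?_⟩
    have hN : (⊤ : SimpleGraph V).neighborSet w = {w}ᶜ := by
      ext
      simp [eq_comm]
    have := Set.ncard_add_ncard_compl {w}
    rw [Set.ncard_singleton, hcard] at this
    rw [hN]
    omega
  | @add V G v hv hdeg _ ih =>
    -- If the edge contains the last vertex `v`, its end `x` other than `v` is replaced by the edge
    -- joining the two neighbors of `v`.
    have key : ∀ x, G.Adj v x →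
        ∃ w, w ≠ v ∧ w ≠ x ∧ G.IsSimplicial w ∧ (G.neighborSet w).ncard = 2 := by
      intro x hvx
      obtain ⟨q, hxq, hN⟩ := neighborSet_eq_pair_of_ncard_eq_two hdeg hvx
      have hvq : G.Adj v q := by
        change q ∈ G.neighborSet v
        simp [hN]
      obtain ⟨⟨w, hwv⟩, hwx', hwq', hs, hd⟩ := ih (x := ⟨x, hvx.ne'⟩) (y := ⟨q, hvq.ne'⟩)
        (hv hvx hvq hxq)
      have hwx : w ≠ x := fun h => hwx' (Subtype.ext h)
      have hwq : w ≠ q := fun h => hwq' (Subtype.ext h)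
      refine ⟨w, hwv, hwx, simplicial_of_induce hwv (fun u hwu => ?_) hs hd⟩
      rintro rfl
      have : w ∈ G.neighborSet u := hwu.symm
      rw [hN] at this
      exact this.elim hwx hwq
    by_cases hx : x = v
    · subst hx
      exact key y hxy
    by_cases hy : y = v
    · subst hy
      obtain ⟨w, h1, h2, h3⟩ := key x hxy.symm
      exact ⟨w, h2, h1, h3⟩
    · exact ⟨v, Ne.symm hx, Ne.symm hy, hv, hdeg⟩

/-- In a graph built from a cycle of length at least four, every edge is the root of an induced
minor model of a 4-cycle. For an edge `v x` with `v` the last vertex added, `v` joins the branch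
set of the other neighbor `q` of `v` in a model rooted at `q x`. -/
theorem BuiltFrom.exists_isRootedSquare {V : Type u} {G : SimpleGraph V} {n : ℕ} (hn : 4 ≤ n)
    (h : BuiltFrom (cycleGraph n) G) {x y : V} (hxy : G.Adj x y) :
    ∃ S, G.IsRootedSquare x y S := by
  induction h with
  | base G e =>
    have hcyc := isInducedCycle_of_embedding (by omega) e.symm.toEmbedding
    have hall : ∀ z, z ∈ (fun i => e.symm.toEmbedding ⟨i % n, Nat.mod_lt _ (by omega)⟩) ''
        Set.Iio n := fun z =>
      ⟨(e z).val, (e z).2, by simp [Nat.mod_eq_of_lt]⟩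
    obtain ⟨S, hS, -⟩ := hcyc.exists_isRootedSquare hn (hall x) (hall y) hxy
    exact ⟨S, hS⟩
  | add G v hv hdeg _ ih =>
    have key : ∀ x, G.Adj v x → ∃ S, G.IsRootedSquare v x S := by
      intro x hvx
      obtain ⟨q, hxq, hN⟩ := neighborSet_eq_pair_of_ncard_eq_two hdeg hvx
      have hvq : G.Adj v q := by
        change q ∈ G.neighborSet v
        simp [hN]
      obtain ⟨S, hS⟩ := ih (x := ⟨q, hvq.ne'⟩) (y := ⟨x, hvx.ne'⟩) (hv hvq hvx hxq.symm)
      have hS := hS.map (Embedding.induce {v}ᶜ)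
      set P : Fin 4 → Set _ := fun i => (Embedding.induce {v}ᶜ : G.induce {v}ᶜ ↪g G) '' S i
      change G.IsRootedSquare q x P at hS
      have hvP : ∀ i, v ∉ P i := by
        rintro i ⟨w, -, hw⟩
        exact w.2 hw
      have hvadj : ∀ i, i ≠ 0 → ∀ w ∈ P i, G.Adj v w → i = 1 := by
        intro i hi w hw hvw
        have : w ∈ G.neighborSet v := hvw
        rw [hN] at this
        by_contra hi1
        rcases this with rfl | rfl
        · exact (hS.model.disjoint i 1 hi1).ne_of_mem hw hS.right_mem rfl
        · exact (hS.model.disjoint i 0 hi).ne_of_mem hw hS.left_mem rfl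
      refine ⟨fun i => if i = 0 then insert v (P 0) else P i,
        ⟨isInducedMinorModel_of_lt ?_ ?_ ?_, by simp, by simpa using hS.right_mem⟩⟩
      · intro i j hij
        have hj : j ≠ 0 := fun h => by simp [h] at hij
        rw [if_neg hj]
        split_ifs with hi
        · subst hi
          exact Set.disjoint_insert_left.2 ⟨hvP j, hS.model.disjoint _ _ hij.ne⟩
        · exact hS.model.disjoint _ _ hij.ne
      · intro i
        by_cases hi : i = 0
        · rw [if_pos hi]
          exact induce_insert_connected (hS.model.connected 0) hS.left_mem hvq.symm
        · rw [if_neg hi]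
          exact hS.model.connected i
      · intro i j hij
        have hj : j ≠ 0 := fun h => by simp [h] at hij
        rw [hS.model.adj_iff i j hij.ne, if_neg hj]
        split_ifs with hi
        · subst hi
          refine ⟨fun ⟨a, ha, h⟩ => ⟨a, .inr ha, h⟩, ?_⟩
          rintro ⟨a, rfl | ha, b, hb, hab⟩
          · have := hvadj j hj b hb hab
            subst this
            exact ⟨q, hS.left_mem, x, hS.right_mem, hv hvq hvx hxq.symm⟩
          · exact ⟨a, ha, b, hb, hab⟩
        · rfl
    by_cases hx : x = v
    · subst hx
      exact key y hxy
    by_cases hy : y = v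
    · subst hy
      obtain ⟨S, hS⟩ := key x hxy.symm
      exact ⟨_, hS.symm⟩
    · obtain ⟨S, hS⟩ := ih (x := ⟨x, hx⟩) (y := ⟨y, hy⟩) hxy
      exact ⟨_, hS.map (Embedding.induce {v}ᶜ)⟩

/-! ### Biconnected graphs -/

/-- In a biconnected graph, a nonempty vertex set that misses `v` and is closed under adjacency
away from `v` contains every vertex other than `v`. -/
theorem IsBiconnected.mem_of_closed (hG : G.IsBiconnected) {v : V} {R : Set V} (hv : v ∉ R)
    (hne : R.Nonempty) (hcl : ∀ u ∈ R, ∀ w, w ≠ v → G.Adj u w → w ∈ R) {z : V} (hz : z ≠ v) :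
    z ∈ R := by
  have h := not_not.1 (hG.2 v)
  rw [induce_preconnected_iff] at h
  exact h R (fun u hu huv => hv (huv ▸ hu)) hne (fun u hu w hw huw => hcl u hu w hw huw) hz

theorem induce_induce_preconnected {T : Set V} {S : Set T}
    (h : (G.induce (Subtype.val '' S)).Preconnected) : ((G.induce T).induce S).Preconnected := by
  rw [induce_preconnected_iff] at h ⊢
  intro R hRS hne hcl s hs
  have := h (Subtype.val '' R) (Set.image_mono hRS) (hne.image _) ?_ ⟨s, hs, rfl⟩
  · obtain ⟨t, ht, hts⟩ := this
    rwa [← Subtype.ext hts]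
  · rintro _ ⟨u, hu, rfl⟩ _ ⟨v, hv, rfl⟩ huv
    exact ⟨v, hcl u hu v hv huv, rfl⟩

/-- Let `T` be attached to the rest of the graph only along the edge `x y`. Deleting a vertex set
`F` that avoids `x` leaves `T` connected if it leaves the whole graph connected. -/
theorem induce_diff_preconnected {F T : Set V} (hF : (G.induce Fᶜ).Preconnected) {x y : V}
    (hxy : G.Adj x y) (hx : x ∈ T) (hT : ∀ u ∈ T, u ≠ x → u ≠ y → ∀ w, G.Adj u w → w ∈ T)
    (hxF : x ∉ F) : (G.induce (T \ F)).Preconnected := by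
  rw [induce_preconnected_iff] at hF ⊢
  -- A closed subset of `T \ F` without `x` is closed in the whole graph, hence empty.
  have key : ∀ Q ⊆ T \ F, x ∉ Q → (∀ u ∈ Q, ∀ v ∈ T \ F, G.Adj u v → v ∈ Q) → Q = ∅ := by
    intro Q hQ hxQ hcl
    by_contra hne
    refine hxQ (hF Q (fun u hu => (hQ hu).2) (Set.nonempty_iff_ne_empty.2 hne) ?_ hxF)
    intro u hu w hw huw
    have huy : u ≠ y := by
      rintro rfl
      exact hxQ (hcl u hu x ⟨hx, hxF⟩ hxy.symm)
    exact hcl u hu w ⟨hT u (hQ hu).1 (fun h => hxQ (h ▸ hu)) huy w huw, hw⟩ huw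
  intro R hR hne hcl
  by_cases hxR : x ∈ R
  · have := key ((T \ F) \ R) Set.sdiff_subset (fun h => h.2 hxR) fun u hu v hv huv =>
      ⟨hv, fun hvR => hu.2 (hcl v hvR u hu.1 huv.symm)⟩
    exact Set.sdiff_eq_empty.1 this
  · exact absurd (key R hR hxR hcl) hne.ne_empty

/-- A part of a biconnected graph attached to the rest only along an edge is biconnected. -/
theorem IsBiconnected.induce (hG : G.IsBiconnected) {T : Set V} {x y : V} (hxy : G.Adj x y)
    (hx : x ∈ T) (hy : y ∈ T) (hT : ∀ u ∈ T, u ≠ x → u ≠ y → ∀ w, G.Adj u w → w ∈ T) :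
    (G.induce T).IsBiconnected := by
  have : Nonempty T := ⟨⟨x, hx⟩⟩
  refine ⟨⟨?_⟩, fun v => not_not.2 (induce_induce_preconnected ?_)⟩
  · have h : (G.induce (∅ : Set V)ᶜ).Preconnected := by
      rw [Set.compl_empty]
      exact (induceUnivIso G).preconnected_iff.2 hG.1.preconnected
    have := induce_diff_preconnected h hxy hx hT (Set.notMem_empty x)
    rwa [Set.sdiff_empty] at this
  · have himg : Subtype.val '' ({v}ᶜ : Set T) = T \ {v.1} := by
      ext u
      simp only [Set.mem_image, Set.mem_compl_iff, Set.mem_singleton_iff, Set.mem_sdiff]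
      constructor
      · rintro ⟨w, hw, rfl⟩
        exact ⟨w.2, fun h => hw (Subtype.ext h)⟩
      · rintro ⟨hu, huv⟩
        exact ⟨⟨u, hu⟩, fun h => huv (congrArg Subtype.val h), rfl⟩
    rw [himg]
    have hv := not_not.1 (hG.2 v)
    by_cases hxv : x = v
    · exact induce_diff_preconnected hv hxy.symm hy (fun u hu h1 h2 => hT u hu h2 h1)
        fun h => hxy.ne (hxv.trans h.symm)
    · exact induce_diff_preconnected hv hxy hx hT hxv

theorem dist_getVert {u v : V} {p : G.Walk u v} (hp : p.length = G.dist u v) {i j : ℕ}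
    (hij : i ≤ j) (hj : j ≤ p.length) : G.dist (p.getVert i) (p.getVert j) = j - i := by
  have h := length_eq_dist_of_subwalk hp
    (((p.take j).isSubwalk_drop i).trans (p.isSubwalk_take j))
  rw [Walk.drop_length, Walk.take_length, Walk.take_getVert, min_eq_left hj,
    min_eq_right hij] at h
  exact h.symm

/-- A biconnected graph with at least three vertices has an induced cycle: a vertex `v` together
with a geodesic of `G - v` between two neighbors of `v` that are as close as possible in `G - v`. -/
theorem IsBiconnected.exists_isInducedCycle [Finite V] (hG : G.IsBiconnected)
    (hc : 3 ≤ Nat.card V) : ∃ n f, 3 ≤ n ∧ G.IsInducedCycle n f := by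
  classical
  obtain ⟨v⟩ := hG.1.nonempty
  have hex : ∀ a, ∃ z, z ≠ v ∧ z ≠ a := by
    intro a
    by_contra! hall
    have hsub : (Set.univ : Set V) ⊆ {v, a} := fun z _ => by
      by_cases hz : z = v
      · exact .inl hz
      · exact .inr (hall z hz)
    have := Set.ncard_le_ncard hsub (Set.toFinite _)
    rw [Set.ncard_univ] at this
    have := Set.ncard_insert_le v {a}
    rw [Set.ncard_singleton] at this
    omega
  have hnbr : ∀ a ≠ v, ∃ b, b ≠ a ∧ G.Adj v b := by
    intro a ha
    by_contra! hall
    obtain ⟨z, hzv, hza⟩ := hex a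
    refine hzv (hG.mem_of_closed (v := a) (R := {v}) ha (Set.singleton_nonempty v) ?_ hza)
    rintro u rfl w hw huw
    exact absurd huw (hall w hw)
  obtain ⟨a₀, ha₀, -⟩ := hex v
  obtain ⟨a, -, hva⟩ := hnbr a₀ ha₀
  obtain ⟨b, hba, hvb⟩ := hnbr a hva.ne'
  let H := G.induce ({v}ᶜ : Set V)
  have hH : H.Preconnected := not_not.1 (hG.2 v)
  have hmin : ∃ d, ∃ a b : ({v}ᶜ : Set V), a ≠ b ∧ G.Adj v a ∧ G.Adj v b ∧ H.dist a b = d :=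
    ⟨_, ⟨a, hva.ne'⟩, ⟨b, hvb.ne'⟩, fun h => hba (congrArg Subtype.val h).symm, hva, hvb, rfl⟩
  obtain ⟨a, b, hab, hva, hvb, hd⟩ := Nat.find_spec hmin
  have hleast : ∀ a' b' : ({v}ᶜ : Set V), a' ≠ b' → G.Adj v a' → G.Adj v b' →
      H.dist a b ≤ H.dist a' b' := fun a' b' h1 h2 h3 =>
    hd ▸ Nat.find_min' hmin ⟨a', b', h1, h2, h3, rfl⟩
  obtain ⟨p, hp⟩ := (hH a b).exists_walk_length_eq_dist
  have hpos : 0 < p.length := hp ▸ (hH a b).pos_dist_of_ne hab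
  have hdist : ∀ i j, i ≤ j → j ≤ p.length → H.dist (p.getVert i) (p.getVert j) = j - i :=
    fun i j => dist_getVert hp
  -- An inner vertex of `p` adjacent to `v` would be closer to `a` than `b` is.
  have hvp : ∀ i ≤ p.length, (G.Adj v (p.getVert i) ↔ i = 0 ∨ i = p.length) := by
    intro i hi
    constructor
    · intro h
      by_contra! hne
      have h0 := hdist 0 i (Nat.zero_le i) hi
      rw [Walk.getVert_zero] at h0
      have := hleast a (p.getVert i) (fun h => by
        rw [← h, dist_self] at h0
        omega) hva h
      omega
    · rintro (rfl | rfl)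
      · rwa [Walk.getVert_zero]
      · rwa [Walk.getVert_length]
  refine ⟨p.length + 2, fun i => if i = 0 then v else p.getVert (i - 1), by omega, ?_, ?_⟩
  · have hlt : ∀ i j, i < j → j < p.length + 2 →
        (if i = 0 then v else (p.getVert (i - 1)).1) ≠
          if j = 0 then v else (p.getVert (j - 1)).1 := by
      intro i j hij hj h
      rw [if_neg (by omega : j ≠ 0)] at h
      split_ifs at h with hi
      · exact (p.getVert (j - 1)).2 h.symm
      · have := hdist (i - 1) (j - 1) (by omega) (by omega)
        rw [Subtype.ext h, dist_self] at this
        omega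
    intro i hi j hj hij
    rcases lt_trichotomy i j with h | h | h
    · exact absurd hij (hlt i j h hj)
    · exact h
    · exact absurd hij.symm (hlt j i h hi)
  · intro i j hij hj
    rw [if_neg (by omega : j ≠ 0)]
    split_ifs with hi
    · rw [hvp _ (by omega)]
      omega
    · change H.Adj (p.getVert (i - 1)) (p.getVert (j - 1)) ↔ _
      rw [← dist_eq_one_iff_adj, hdist _ _ (by omega) (by omega)]
      omega

theorem exists_component {C : Set V} {w : V} (hw : w ∉ C) : ∃ K : Set V, w ∈ K ∧ Disjoint K C ∧
    (G.induce K).Connected ∧ ∀ u ∈ K, ∀ z ∉ C, G.Adj u z → z ∈ K := by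
  let c := (G.induce Cᶜ).connectedComponentMk ⟨w, hw⟩
  refine ⟨Subtype.val '' c.supp, ⟨⟨w, hw⟩, rfl, rfl⟩, ?_,
    induce_connected_image (Embedding.induce Cᶜ)
      (ConnectedComponent.maximal_connected_induce_supp c).1, ?_⟩
  · rw [Set.disjoint_left]
    rintro _ ⟨u, -, rfl⟩
    exact u.2
  · rintro _ ⟨u, hu, rfl⟩ z hz huz
    exact ⟨⟨z, hz⟩, (c.mem_supp_congr_adj (v := u) (w := ⟨z, hz⟩) huz).1 hu, rfl⟩

/-! ### The structure of biconnected graphs without the forbidden minors -/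

theorem IsInducedCycle.ncard_image {n : ℕ} {f : ℕ → V} (h : G.IsInducedCycle n f) :
    (f '' Set.Iio n).ncard = n := by
  have hinj : Set.InjOn f (Set.Iio n) := fun i hi j hj hij => h.inj i hi j hj hij
  rw [hinj.ncard_image]
  simp [Set.ncard_eq_toFinset_card']

/-- A component `K` of the complement of an induced cycle of a biconnected graph without the
forbidden minors is attached to the cycle exactly at the two ends of an edge. -/
theorem IsBiconnected.exists_attachment (hG : G.IsBiconnected)
    (hK4 : G.MinorFree (completeGraph (Fin 4)))
    (hK23 : G.InducedMinorFree (completeBipartiteGraph (Fin 2) (Fin 3))) {n : ℕ} {f : ℕ → V}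
    (hn : 3 ≤ n) (hf : G.IsInducedCycle n f) {K : Set V} (hK : (G.induce K).Connected)
    (hKC : Disjoint K (f '' Set.Iio n))
    (hcl : ∀ u ∈ K, ∀ z ∉ f '' Set.Iio n, G.Adj u z → z ∈ K) :
    ∃ x ∈ f '' Set.Iio n, ∃ y ∈ f '' Set.Iio n, G.Adj x y ∧ (∃ k ∈ K, G.Adj k x) ∧
      ∀ z ∈ f '' Set.Iio n, (∃ k ∈ K, G.Adj k z) → z = x ∨ z = y := by
  have hKne : K.Nonempty := (induce_connected_iff.1 hK).1
  have hnot : ∀ i < n, f i ∉ K := fun i hi h => hKC.ne_of_mem h ⟨i, hi, rfl⟩ rfl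
  -- Otherwise `c` would be a cut vertex.
  have hother : ∀ i < n, ∃ z ∈ f '' Set.Iio n, z ≠ f i ∧ ∃ k ∈ K, G.Adj k z := by
    intro i hi
    by_contra! hall
    obtain ⟨j, hj, hji⟩ : ∃ j < n, j ≠ i := by
      rcases Nat.eq_zero_or_pos i with rfl | h
      · exact ⟨1, by omega, by omega⟩
      · exact ⟨0, by omega, by omega⟩
    refine hnot j hj (hG.mem_of_closed (hnot i hi) hKne ?_ fun h => hji (hf.inj j hj i hi h))
    intro u hu w hw huw
    by_cases hwC : w ∈ f '' Set.Iio n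
    · exact absurd huw (hall w hwC hw u hu)
    · exact hcl u hu w hwC huw
  obtain ⟨_, ⟨i, hi, rfl⟩, -, hx⟩ := hother 0 (by omega)
  obtain ⟨_, ⟨j, hj, rfl⟩, hne, hy⟩ := hother i hi
  have honly : ∀ z ∈ f '' Set.Iio n, (∃ k ∈ K, G.Adj k z) → z = f i ∨ z = f j := by
    intro z hz hKz
    by_contra! hzne
    exact hf.not_minorFree_of_three hK hKC ⟨i, hi, rfl⟩ ⟨j, hj, rfl⟩ hz hne.symm hzne.1.symm
      hzne.2.symm hx hy hKz hK4
  refine ⟨f i, ⟨i, hi, rfl⟩, f j, ⟨j, hj, rfl⟩, ?_, hx, honly⟩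
  by_contra hadj
  exact hf.not_inducedMinorFree_of_two hK hKC ⟨i, hi, rfl⟩ ⟨j, hj, rfl⟩ hne.symm hadj hx hy honly
    hK23

/-- A biconnected graph without the forbidden minors has at most two vertices or is built from a
cycle. If an induced cycle, of length at least four if possible, is not the whole graph, then a part
of the graph is attached to it along an edge `x y`. By induction this part is built from a cycle;
it is a 2-tree, for otherwise the squares rooted at `x y` on both sides give a domino. So
it has a simplicial vertex of degree two other than `x` and `y`, which can be removed from the
whole graph. -/
theorem IsBiconnected.builtFrom_cycleGraph {N : ℕ} : ∀ {V : Type u} [Finite V]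
    {G : SimpleGraph V}, Nat.card V = N → G.IsBiconnected → G.MinorFree (completeGraph (Fin 4)) →
    G.InducedMinorFree (completeBipartiteGraph (Fin 2) (Fin 3)) → G.InducedMinorFree domino →
    3 ≤ N → ∃ n : ℕ, 3 ≤ n ∧ BuiltFrom (cycleGraph n) G := by
  induction N using Nat.strong_induction_on with
  | _ N ih =>
  intro V _ G hN hG hK4 hK23 hdom hN3
  have hcyc : ∃ n f, 3 ≤ n ∧ G.IsInducedCycle n f ∧
      ((∃ m g, 4 ≤ m ∧ G.IsInducedCycle m g) → 4 ≤ n) := by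
    by_cases hhole : ∃ m g, 4 ≤ m ∧ G.IsInducedCycle m g
    · obtain ⟨m, g, hm, hg⟩ := hhole
      exact ⟨m, g, by omega, hg, fun _ => hm⟩
    · obtain ⟨n, f, hn, hf⟩ := hG.exists_isInducedCycle (hN ▸ hN3)
      exact ⟨n, f, hn, hf, fun h => absurd h hhole⟩
  obtain ⟨n, f, hn, hf, hlong⟩ := hcyc
  set C := f '' Set.Iio n with hC
  have hCcard : C.ncard = n := hf.ncard_image
  by_cases hall : ∀ w, w ∈ C
  · refine ⟨n, hn, .base _ (RelIso.symm ⟨Equiv.ofBijective hf.embedding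
      ⟨hf.embedding.injective, fun w => ?_⟩, hf.embedding.map_rel_iff⟩)⟩
    obtain ⟨i, hi, rfl⟩ := hall w
    exact ⟨⟨i, hi⟩, rfl⟩
  push Not at hall
  obtain ⟨w, hw⟩ := hall
  obtain ⟨K, hwK, hKC, hK, hcl⟩ := exists_component (G := G) hw
  obtain ⟨x, hx, y, hy, hxy, -, honly⟩ := hG.exists_attachment hK4 hK23 hn hf hK hKC hcl
  set T : Set V := insert x (insert y K) with hT
  have hxT : x ∈ T := .inl rfl
  have hyT : y ∈ T := .inr (.inl rfl)
  have hKT : ∀ u ∈ T, u ≠ x → u ≠ y → u ∈ K := fun u hu h1 h2 =>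
    (hu.resolve_left h1).resolve_left h2
  have hTcl : ∀ u ∈ T, u ≠ x → u ≠ y → ∀ z, G.Adj u z → z ∈ T := by
    intro u hu h1 h2 z huz
    by_cases hz : z ∈ C
    · exact (honly z hz ⟨u, hKT u hu h1 h2, huz⟩).elim (fun h => .inl h) fun h => .inr (.inl h)
    · exact .inr (.inr (hcl u (hKT u hu h1 h2) z hz huz))
  have hTC : ∀ v ∈ T, v ∈ C → v = x ∨ v = y := by
    rintro v (rfl | rfl | hv) hvC
    exacts [.inl rfl, .inr rfl, absurd rfl (hKC.ne_of_mem hv hvC)]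
  -- The part `T` has at least three vertices, but fewer than `G`.
  have hTlt : Nat.card T < N := by
    obtain ⟨c, hcC, hc⟩ := Set.exists_mem_notMem_of_ncard_lt_ncard (s := {x, y}) (t := C)
      (by rw [Set.ncard_pair hxy.ne, hCcard]; omega) (Set.toFinite _)
    rw [Nat.card_coe_set_eq, ← hN, ← Set.ncard_univ]
    exact Set.ncard_lt_ncard ⟨Set.subset_univ _, fun h => hc (hTC c (h trivial) hcC)⟩
      (Set.toFinite _)
  have hT3 : 3 ≤ Nat.card T := by
    have hwxy : w ∉ ({x, y} : Set V) := by
      rintro (rfl | rfl)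
      exacts [hw hx, hw hy]
    have h3 : (insert w {x, y} : Set V).ncard = 3 := by
      rw [Set.ncard_insert_of_notMem hwxy, Set.ncard_pair hxy.ne]
    rw [Nat.card_coe_set_eq, ← h3]
    refine Set.ncard_le_ncard ?_ (Set.toFinite _)
    rintro _ (rfl | rfl | rfl)
    exacts [.inr (.inr hwK), hxT, hyT]
  obtain ⟨m, hm, hbuilt⟩ := ih _ hTlt rfl (hG.induce hxy hxT hyT hTcl) (hK4.induce T)
    (hK23.induce T) (hdom.induce T) hT3
  rcases hm.eq_or_lt with rfl | hm4
  · obtain ⟨⟨s, hsT⟩, hsx, hsy, hs, hd⟩ :=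
      hbuilt.exists_simplicial (x := ⟨x, hxT⟩) (y := ⟨y, hyT⟩) hxy
    have hsx : s ≠ x := fun h => hsx (Subtype.ext h)
    have hsy : s ≠ y := fun h => hsy (Subtype.ext h)
    obtain ⟨hs, hd⟩ := simplicial_of_induce hsT (hTcl s hsT hsx hsy) hs hd
    obtain ⟨a, b, hab, hab'⟩ := Set.ncard_eq_two.1 hd
    have hsa : G.Adj s a := by
      change a ∈ G.neighborSet s
      simp [hab']
    have hsb : G.Adj s b := by
      change b ∈ G.neighborSet s
      simp [hab']
    have hbic : (G.induce {s}ᶜ).IsBiconnected := by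
      refine hG.induce (hs hsa hsb hab) hsa.ne' hsb.ne' ?_
      rintro u - hua hub z huz rfl
      have : u ∈ G.neighborSet z := huz.symm
      rw [hab'] at this
      exact this.elim hua hub
    have hlt : Nat.card ({s}ᶜ : Set V) < N := by
      have := Set.ncard_add_ncard_compl {s}
      rw [Set.ncard_singleton, hN] at this
      rw [Nat.card_coe_set_eq]
      omega
    have h3 : 3 ≤ Nat.card ({s}ᶜ : Set V) := by
      rw [Nat.card_coe_set_eq]
      refine (hCcard ▸ hn).trans (Set.ncard_le_ncard ?_ (Set.toFinite _))
      rintro c hc rfl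
      exact (hTC c hsT hc).elim hsx hsy
    obtain ⟨k, hk, hbk⟩ := ih _ hlt rfl hbic (hK4.induce _) (hK23.induce _) (hdom.induce _) h3
    exact ⟨k, hk, .add G s hs hd hbk⟩
  · obtain ⟨e⟩ := hbuilt.nonempty_embedding
    have hn4 := hlong ⟨m, _, hm4,
      isInducedCycle_of_embedding (by omega) ((Embedding.induce T).comp e)⟩
    obtain ⟨S, hS⟩ := hbuilt.exists_isRootedSquare hm4 (x := ⟨x, hxT⟩) (y := ⟨y, hyT⟩) hxy
    obtain ⟨S', hS', hS'C⟩ := hf.exists_isRootedSquare hn4 hx hy hxy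
    refine absurd hdom (not_inducedMinorFree_domino (hS.map (Embedding.induce T)) hS' (T := T)
      (T' := C) ?_ hS'C hTC fun u hu v hv huv => ?_)
    · rintro i _ ⟨u, -, rfl⟩
      exact u.2
    · by_cases hux : u = x
      · exact .inl (hux ▸ hx)
      by_cases huy : u = y
      · exact .inl (huy ▸ hy)
      exact .inr (hTcl u hu hux huy v huv)

theorem isK_one_or_two_of_card [Finite V] (hG : G.Connected) (hc : Nat.card V < 3) :
    G.IsK 1 ∨ G.IsK 2 := by
  have hne := hG.nonempty
  have h0 : 0 < Nat.card V := Nat.card_pos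
  have htop : G = ⊤ := by
    ext u v
    rw [top_adj]
    refine ⟨Adj.ne, fun huv => ?_⟩
    have hall : ∀ w, w = u ∨ w = v := by
      by_contra! ⟨w, hwu, hwv⟩
      have h3 : ({w, u, v} : Set V).ncard = 3 := Set.ncard_eq_three.2 ⟨w, u, v, hwu, hwv, huv, rfl⟩
      have := Set.ncard_le_ncard (Set.subset_univ {w, u, v}) (Set.toFinite _)
      rw [h3, Set.ncard_univ] at this
      omega
    by_contra hadj
    refine huv ?_
    refine (preconnected_iff_forall_closed.1 hG.preconnected {u} (Set.singleton_nonempty u)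
      ?_ v).symm
    rintro _ rfl w huw
    rcases hall w with rfl | rfl
    exacts [rfl, absurd huw hadj]
  rw [isK_iff, isK_iff]
  have : Nat.card V = 1 ∨ Nat.card V = 2 := by omega
  exact this.imp (⟨·, htop⟩) (⟨·, htop⟩)

theorem IsK.onePerfectlyOrientable {n : ℕ} (h : G.IsK n) : G.OnePerfectlyOrientable := by
  obtain ⟨e⟩ := h
  refine ⟨⟨fun v w => e v < e w⟩, ⟨⟨fun v w => ?_, fun v w => lt_asymm⟩, fun v x y _ _ hxy => ?_⟩⟩
  · exact e.map_adj_iff.symm.trans lt_or_lt_iff_ne.symm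
  · exact (lt_or_gt_of_ne (e.injective.ne hxy)).imp (fun h => ⟨h, lt_asymm h⟩)
      fun h => ⟨h, lt_asymm h⟩

end SimpleGraph

theorem mainTheorem9 {V : Type*} [Finite V] (G : SimpleGraph V) (hG : G.IsBiconnected)
    (hK4 : G.MinorFree (SimpleGraph.completeGraph (Fin 4))) :
    List.TFAE [
      G.OnePerfectlyOrientable,
      G.InducedMinorFree (completeBipartiteGraph (Fin 2) (Fin 3)) ∧
        G.InducedMinorFree SimpleGraph.domino,
      G.IsK 1 ∨ G.IsTwoTree ∨ G.IsHollowedTwoTree,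
      G.IsK 1 ∨ G.IsK 2 ∨ ∃ n : ℕ, 3 ≤ n ∧ SimpleGraph.BuiltFrom (SimpleGraph.cycleGraph n) G,
      G.IsK 1 ∨ G.IsK 2 ∨ ∃ D : Digraph V, G.IsOnePerfectOrientation D ∧ D.SinkFree] := by
  tfae_have 1 → 2 := fun h =>
    ⟨h.inducedMinorFree_completeBipartiteGraph, h.inducedMinorFree_domino⟩
  tfae_have 2 → 4 := by
    rintro ⟨h1, h2⟩
    rcases Nat.lt_or_ge (Nat.card V) 3 with hc | hc
    · exact (SimpleGraph.isK_one_or_two_of_card hG.1 hc).imp_right .inl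
    · exact .inr (.inr (hG.builtFrom_cycleGraph rfl hK4 h1 h2 hc))
  tfae_have 4 → 5 := by
    rintro (h | h | ⟨n, hn, h⟩)
    exacts [.inl h, .inr (.inl h), .inr (.inr (h.exists_orientation hn))]
  tfae_have 5 → 1 := by
    rintro (h | h | ⟨D, hD, -⟩)
    exacts [h.onePerfectlyOrientable, h.onePerfectlyOrientable, ⟨D, hD⟩]
  tfae_have 3 ↔ 4 := by
    refine or_congr_right ?_
    rw [SimpleGraph.isTwoTree_iff, or_assoc]
    refine or_congr_right ⟨?_, ?_⟩
    · rintro (h | ⟨n, hn, h⟩)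
      exacts [⟨3, le_rfl, h⟩, ⟨n, by omega, h⟩]
    · rintro ⟨n, hn, h⟩
      rcases hn.eq_or_lt with rfl | hn
      exacts [.inl h, .inr ⟨n, hn, h⟩]
  tfae_finish
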